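/- Corollary 5.4 (compact minimal invariant torus). Let $\mathcal T^m=\mathbb R^m/\mathbb Z^m$, let $E$ be a Banach space, and let $\Phi$ be a continuous vector field on $\mathcal T^m$ such that $\omega'=\Phi(\omega)$ generates a continuous flow $\sigma(t,\omega)=\omega t$ $(t\in\mathbb R)$ on $\mathcal T^m$. Suppose that this flow is compact minimal (every orbit is dense) and contains only quasi-periodic motions. Conventions. A motion $x(t)$ is quasi-periodic if $x(t)=\Psi(\nu_1t,\dots,\nu_kt)$ for a continuous $\Psi$ that is $1$-periodic in each of its $k$ variables and rationally independent $\nu_1,\dots,\nu_k$. Consider an equation $x'=G(\omega t,x)$, where $G(\omega,x)$ is given for $\omega\in\mathcal T^m$ and $x\in D\subseteq E$; let $\varphi(t,x,\omega)$ be the solution on $\mathbb R_+$ with values in $D$ and $\varphi(0,x,\omega)=x$. An invariant torus of the equation is a function $u\in C(\mathcal T^m,E)$ such that for all $\omega$ the solution $\varphi(\cdot,u(\omega),\omega)$ exists, is unique, and $u(\omega t)=\varphi(t,u(\omega),\omega)$ for all $t\ge0$. It is called compact minimal and quasi-periodic if its graph $\mathcal M=\{(u(\omega),\omega)\}$ is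 a compact minimal set of the skew-product system $\pi(t,(x,\omega))=(\varphi(t,x,\omega),\omega t)$, $t\ge0$ (i.e. $\mathcal M$ is compact and invariant, and the orbit of each of its points has closure $\mathcal M$), and the motion of every point of $\mathcal M$ is quasi-periodic. Let $A\in C(\mathcal T^m,L(E))$, $f\in C(\mathcal T^m,E)$, $F\in C(\mathcal T^m\times E,E)$. Let $U(t,\omega)$ be the Cauchy operator of $x'=A(\omega t)x$ ($U(0,\omega)=I$). The linear equation is hyperbolic with constants $N,\nu>0$ and projections $P\in C(\mathcal T^m,L(E))$, $P(\omega)^2=P(\omega)$, if for all $\omega$: $U(t,\omega)P(\omega)=P(\omega t)U(t,\omega)$ for all $t$; $\|U(t,\omega)P(\omega)U^{-1}(\tau,\omega)\|\le Ne^{-\nu(t-\tau)}$ for $t\ge\tau$; and $\|U(t,\omega)(I-P(\omega))U^{-1}(\tau,\omega)\|\le Ne^{\nu(t-\tau)}$ for $t\le\tau$. Put $$\gamma(\omega)=\int_{-\infty}^0 P(\omega)U^{-1}(\tau,\omega)f(\omega\tau)\,d\tau-\int_0^{\infty}(I-P(\omega))U^{-1}(\tau,\omega)f(\omega\tau)\,d\tau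 ,$$ $\gamma_0=\max_\omega\|F(\omega,\gamma(\omega))\|$, and $B[Q,r]=\{x\in E:\operatorname{dist}(x,Q)\le r\}$ with $Q=\gamma(\mathcal T^m)$. (1) Suppose that $x'=A(\omega t)x$ is hyperbolic with constants $N,\nu$; that there are $0<L<\frac{\nu}{2N}$ and $r>0$ with $r\ge\gamma_0\left(\frac{\nu}{2N}-L\right)^{-1}$ and $\|F(\omega,x_1)-F(\omega,x_2)\|\le L\|x_1-x_2\|$ for all $\omega\in\mathcal T^m$, $x_1,x_2\in B[Q,r]$; and that all initial value problems for $x'=A(\omega t)x+f(\omega t)+F(\omega t,x)$ have a unique solution on $\mathbb R_+$. Then this equation has an invariant torus that is compact minimal and quasi-periodic. (2) Suppose that $x'=A(\omega t)x$ is hyperbolic; that there are $r,L>0$ with $\|F(\omega,x_1)-F(\omega,x_2)\|\le L\|x_1-x_2\|$ for all $\omega\in\mathcal T^m$, $x_1,x_2\in B[Q,r]$; and that, for some $\varepsilon_0>0$ and all $\varepsilon\in[0,\varepsilon_0]$, all initial value problems for $x'=A(\omega t)x+f(\omega t)+\varepsilon F(\omega t,x)$ have a unique solution on $\mathbb R_+$.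 Then there is $\varepsilon_1\in(0,\varepsilon_0]$ such that for all $\varepsilon\in[0,\varepsilon_1]$ this equation has an invariant torus $u_\varepsilon$ that is compact minimal and quasi-periodic, and $\lim_{\varepsilon\downarrow 0}\max_\omega\|u_\varepsilon(\omega)-u_0(\omega)\|=0$. (3) Let $x_0\in E$, $r>0$, $B=B[x_0,r]$ the closed ball, and let $f:\mathcal T^m\times B\to E$ be bounded, continuous, and twice continuously differentiable with respect to $x$ (with $f'_x$, $f''_{xx}$ continuous on $\mathcal T^m\times B$) with $f'_x$ bounded. Suppose that $$\overline f(x)=\lim_{T\to+\infty}\frac1T\int_0^Tf(\omega t,x)\,dt$$ uniformly in $(\omega,x)\in\mathcal T^m\times B$; that $\overline f$ is twice continuously differentiable on $B$ with $\overline f'$ bounded; that $\overline f^{(k)}(x)=\lim_{T\to+\infty}\frac1T\int_0^Tf^{(k)}_x(\omega t,x)\,dt$ for $k=1,2$, uniformly in $(\omega,x)\in\mathcal T^m\times B$; that $\overline f(x_0)=0$; and that the spectrum of $\overline f'(x_0)$ (of its complexification, if $E$ is real) does not meet $i\mathbb R$. Then there is $\rho>0$ such that for every $r_0\in(0,\rho]$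 there is $\varepsilon_1>0$ such that for all $0<\varepsilon<\varepsilon_1$ the equation $x'=\varepsilon f(\omega t,x)$ (on $D=B$) has exactly one invariant torus $u_\varepsilon$ with values in $B[x_0,r_0]$, this torus is compact minimal and quasi-periodic, and $\lim_{\varepsilon\downarrow0}\max_\omega\|u_\varepsilon(\omega)-x_0\|=0$. -/

import Mathlib

open Set Filter Topology TensorProduct

noncomputable section

namespace InvTorus

/-! ### Dynamical systems: compact minimal sets and quasi-periodic motions -/

section Dynamics

variable {X : Type*} [TopologicalSpace X]

/-- `M` is a compact minimal set of the dynamical system `π` with time set `S` (`S = ℝ` or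
`S = ℝ₊`): it is non-empty, compact, invariant, and the closure `H(x)` of the orbit of every
`x ∈ M` is all of `M`. -/
structure IsCompactMinimal (S : Set ℝ) (π : ℝ → X → X) (M : Set X) : Prop where
  nonempty : M.Nonempty
  isCompact : IsCompact M
  invariant : ∀ t ∈ S, π t '' M = M
  orbit_closure : ∀ x ∈ M, closure ((fun t => π t x) '' S) = M

/-- The motion `x : S → X` is quasi-periodic: `x t = Ψ (ν₁ t, …, ν_k t)` for a continuous function
`Ψ` of `k` variables, periodic in each of them, and rationally independent frequencies
`ν₁, …, ν_k` (measured in units of the period). -/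
def IsQuasiPeriodicOn (S : Set ℝ) (x : ℝ → X) : Prop :=
  ∃ (k : ℕ) (ν : Fin k → ℝ) (Ψ : C(UnitAddTorus (Fin k), X)), LinearIndependent ℚ ν ∧
    ∀ t ∈ S, x t = Ψ (fun i => ((ν i * t : ℝ) : UnitAddCircle))

end Dynamics

/-! ### The flow on the torus generated by a vector field -/

/-- The covering map `ℝᵐ → 𝕋ᵐ`. -/
def torusProj {m : ℕ} (x : Fin m → ℝ) : UnitAddTorus (Fin m) :=
  fun i => (x i : UnitAddCircle)

/-- `c : ℝ → 𝕋ᵐ` is an integral curve of the vector field `Φ` (written in the standard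
trivialization `T𝕋ᵐ = 𝕋ᵐ × ℝᵐ`): it is the projection of a curve `x` in `ℝᵐ` that satisfies
`x' = Φ(x mod ℤᵐ)`. -/
def IsIntegralCurve {m : ℕ} (Φ : C(UnitAddTorus (Fin m), Fin m → ℝ))
    (c : ℝ → UnitAddTorus (Fin m)) : Prop :=
  ∃ x : ℝ → Fin m → ℝ, (∀ t, HasDerivAt x (Φ (torusProj (x t))) t) ∧ ∀ t, c t = torusProj (x t)

/-- The equation `ω' = Φ(ω)` on `𝕋ᵐ` generates the flow `σ`: the orbits of `σ` are integral curves
of `Φ`, and every integral curve is an orbit. -/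
structure Generates {m : ℕ} (Φ : C(UnitAddTorus (Fin m), Fin m → ℝ))
    (σ : Flow ℝ (UnitAddTorus (Fin m))) : Prop where
  isIntegralCurve : ∀ ω, IsIntegralCurve Φ (fun t => σ t ω)
  unique : ∀ c, IsIntegralCurve Φ c → ∀ t, c t = σ t (c 0)

/-! ### Nonautonomous equations over a driving flow, and invariant tori -/

variable {Ω : Type*} [TopologicalSpace Ω]
variable {E : Type*} [NormedAddCommGroup E] [NormedSpace ℝ E]

/-- `y` is a solution on `ℝ₊`, with values in the domain `D`, of `y' = G(ωt, y)`, where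
`ωt = σ(t, ω)`. -/
def IsSolution (σ : Flow ℝ Ω) (G : Ω → E → E) (D : Set E) (ω : Ω) (y : ℝ → E) : Prop :=
  ∀ t, 0 ≤ t → y t ∈ D ∧ HasDerivWithinAt y (G (σ t ω) (y t)) (Ici 0) t

/-- The initial value problem `y' = G(ωt, y)`, `y(0) = x` has exactly one solution on `ℝ₊` with
values in `D`. -/
def HasUniqueSolution (σ : Flow ℝ Ω) (G : Ω → E → E) (D : Set E) (ω : Ω) (x : E) : Prop :=
  ∃ y : ℝ → E, (IsSolution σ G D ω y ∧ y 0 = x) ∧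
    ∀ z : ℝ → E, IsSolution σ G D ω z → z 0 = x → EqOn z y (Ici 0)

open Classical in
/-- The solution `φ(t, x, ω)` of `y' = G(ωt, y)`, `y(0) = x` (only used for `t ≥ 0` and where
`HasUniqueSolution` holds; the value is `x` where there is no solution on `ℝ₊`). -/
def solutionMap (σ : Flow ℝ Ω) (G : Ω → E → E) (D : Set E) (t : ℝ) (x : E) (ω : Ω) : E :=
  if h : ∃ y : ℝ → E, IsSolution σ G D ω y ∧ y 0 = x then h.choose t else x

/-- The skew-product system `π(t, (x, ω)) = (φ(t, x, ω), ωt)` on `E × Ω`, for `t ≥ 0`. -/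
def skewProduct (σ : Flow ℝ Ω) (G : Ω → E → E) (D : Set E) (t : ℝ) (p : E × Ω) : E × Ω :=
  (solutionMap σ G D t p.1 p.2, σ t p.2)

/-- `u` is an invariant torus of `x' = G(ωt, x)`: the solution `φ(t, u(ω), ω)` exists on `ℝ₊`, is
unique, and equals `u(ωt)`, for all `ω` and `t ≥ 0`. -/
def IsInvariantTorus (σ : Flow ℝ Ω) (G : Ω → E → E) (D : Set E) (u : C(Ω, E)) : Prop :=
  ∀ ω, HasUniqueSolution σ G D ω (u ω) ∧ ∀ t, 0 ≤ t → u (σ t ω) = solutionMap σ G D t (u ω) ω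

/-- The invariant torus as a subset of the phase space `E × Ω` of the skew-product system. -/
def torusGraph (u : C(Ω, E)) : Set (E × Ω) := {p | p.1 = u p.2}

/-- `u` is an invariant torus of `x' = G(ωt, x)` which, in the skew-product system, is compact
minimal and consists of quasi-periodic motions only. -/
structure IsMinimalQuasiPeriodicTorus (σ : Flow ℝ Ω) (G : Ω → E → E) (D : Set E) (u : C(Ω, E)) :
    Prop where
  isInvariantTorus : IsInvariantTorus σ G D u
  isCompactMinimal : IsCompactMinimal (Ici 0) (skewProduct σ G D) (torusGraph u)
  isQuasiPeriodic : ∀ p ∈ torusGraph u, IsQuasiPeriodicOn (Ici 0) (fun t => skewProduct σ G D t p)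

/-! ### Hyperbolic linear equations and quasilinear equations -/

/-- `U` is the Cauchy (solution) operator of `x' = A(ωt) x`. -/
structure IsCauchyOperator (σ : Flow ℝ Ω) (A : C(Ω, E →L[ℝ] E)) (U : ℝ → Ω → E →L[ℝ] E) :
    Prop where
  map_zero : ∀ ω, U 0 ω = 1
  hasDerivAt : ∀ t ω, HasDerivAt (fun s => U s ω) (A (σ t ω) * U t ω) t

/-- The equation `x' = A(ωt) x`, with Cauchy operator `U`, is hyperbolic, with continuous family of
projections `P` and constants `N, ν`. -/
structure IsHyperbolic (σ : Flow ℝ Ω) (A : C(Ω, E →L[ℝ] E)) (U : ℝ → Ω → E →L[ℝ] E)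
    (P : C(Ω, E →L[ℝ] E)) (N ν : ℝ) : Prop where
  isCauchyOperator : IsCauchyOperator σ A U
  N_pos : 0 < N
  ν_pos : 0 < ν
  projection : ∀ ω, P ω * P ω = P ω
  commute : ∀ t ω, U t ω * P ω = P (σ t ω) * U t ω
  stable : ∀ t τ ω, τ ≤ t →
    ‖U t ω * P ω * Ring.inverse (U τ ω)‖ ≤ N * Real.exp (-ν * (t - τ))
  unstable : ∀ t τ ω, t ≤ τ →
    ‖U t ω * (1 - P ω) * Ring.inverse (U τ ω)‖ ≤ N * Real.exp (ν * (t - τ))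

/-- Green's function `G(t, τ, ω)` of a hyperbolic linear equation (the value on the diagonal
`t = τ` is immaterial). -/
def green (U : ℝ → Ω → E →L[ℝ] E) (P : C(Ω, E →L[ℝ] E)) (t τ : ℝ) (ω : Ω) : E →L[ℝ] E :=
  if τ < t then U t ω * P ω * Ring.inverse (U τ ω)
  else -(U t ω * (1 - P ω) * Ring.inverse (U τ ω))

/-- `γ(ω) = ∫ G(0, τ, ω) f(ωτ) dτ`, over the whole real line. -/
def linearTorus (σ : Flow ℝ Ω) (U : ℝ → Ω → E →L[ℝ] E) (P : C(Ω, E →L[ℝ] E)) (f : C(Ω, E))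
    (ω : Ω) : E :=
  ∫ τ : ℝ, green U P 0 τ ω (f (σ τ ω))

/-- `B[γ(Ω), r]`: the points of `E` at distance at most `r` from `γ(Ω)`. -/
def tube (γ : Ω → E) (r : ℝ) : Set E := {x | Metric.infDist x (range γ) ≤ r}

/-- The right-hand side `A(ω)x + f(ω) + F(ω, x)`. -/
def quasilinear (A : C(Ω, E →L[ℝ] E)) (f : C(Ω, E)) (F : C(Ω × E, E)) (ω : Ω) (x : E) : E :=
  A ω x + f ω + F (ω, x)

/-- `‖F(ω, x₁) - F(ω, x₂)‖ ≤ L ‖x₁ - x₂‖` for all `ω` and all `x₁, x₂ ∈ B`. -/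
def LipschitzInSpace (F : C(Ω × E, E)) (B : Set E) (L : ℝ) : Prop :=
  ∀ ω, ∀ x₁ ∈ B, ∀ x₂ ∈ B, ‖F (ω, x₁) - F (ω, x₂)‖ ≤ L * ‖x₁ - x₂‖

/-! ### Averaging -/

/-- `(1/T) ∫₀ᵀ g(ωt) dt`. -/
def timeAverage {V : Type*} [NormedAddCommGroup V] [NormedSpace ℝ V] (σ : Flow ℝ Ω) (g : Ω → V)
    (T : ℝ) (ω : Ω) : V :=
  T⁻¹ • ∫ t in (0 : ℝ)..T, g (σ t ω)

/-- `gbar(x) = lim (1/T) ∫₀ᵀ g(ωt, x) dt` as `T → ∞`, uniformly in `ω` and `x ∈ B`. -/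
def UniformAverage {V : Type*} [NormedAddCommGroup V] [NormedSpace ℝ V] (σ : Flow ℝ Ω) (B : Set E)
    (g : Ω → E → V) (gbar : E → V) : Prop :=
  TendstoUniformlyOn (fun (T : ℝ) (p : Ω × E) => timeAverage σ (fun ω => g ω p.2) T p.1)
    (fun p => gbar p.2) atTop (univ ×ˢ B)

/-- The first derivative of `g` on `B`. -/
def deriv₁ (B : Set E) (g : E → E) : E → E →L[ℝ] E := fderivWithin ℝ g B

/-- The second derivative of `g` on `B`. -/
def deriv₂ (B : Set E) (g : E → E) : E → E →L[ℝ] E →L[ℝ] E :=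
  fderivWithin ℝ (fderivWithin ℝ g B) B

/-- The spectrum `σ(A) ⊆ ℂ` of a bounded operator on a real Banach space: the spectrum of `A` in the
complexification of the algebra of bounded operators. -/
def complexSpectrum (A : E →L[ℝ] E) : Set ℂ :=
  spectrum ℂ ((1 : ℂ) ⊗ₜ[ℝ] A : ℂ ⊗[ℝ] (E →L[ℝ] E))

/-- The hypotheses on `x' = ε f(ωt, x)` near a hyperbolic stationary point `x₀` of the averaged
equation `x' = ε fbar(x)`, on the ball `B = B[x₀, r]`. -/
structure AveragingConditions (σ : Flow ℝ Ω) (f : Ω → E → E) (fbar : E → E) (x₀ : E) (r : ℝ) :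
    Prop where
  r_pos : 0 < r
  continuousOn : ContinuousOn (fun p : Ω × E => f p.1 p.2) (univ ×ˢ Metric.closedBall x₀ r)
  bounded : ∃ M : ℝ, ∀ ω, ∀ x ∈ Metric.closedBall x₀ r, ‖f ω x‖ ≤ M
  bounded_deriv : ∃ M : ℝ, ∀ ω, ∀ x ∈ Metric.closedBall x₀ r,
    ‖deriv₁ (Metric.closedBall x₀ r) (f ω) x‖ ≤ M
  bounded_deriv_avg : ∃ M : ℝ, ∀ x ∈ Metric.closedBall x₀ r,
    ‖deriv₁ (Metric.closedBall x₀ r) fbar x‖ ≤ M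
  contDiffOn : ∀ ω, ContDiffOn ℝ 2 (f ω) (Metric.closedBall x₀ r)
  continuousOn_deriv₁ : ContinuousOn (fun p : Ω × E => deriv₁ (Metric.closedBall x₀ r) (f p.1) p.2)
    (univ ×ˢ Metric.closedBall x₀ r)
  continuousOn_deriv₂ : ContinuousOn (fun p : Ω × E => deriv₂ (Metric.closedBall x₀ r) (f p.1) p.2)
    (univ ×ˢ Metric.closedBall x₀ r)
  contDiffOn_avg : ContDiffOn ℝ 2 fbar (Metric.closedBall x₀ r)
  average : UniformAverage σ (Metric.closedBall x₀ r) f fbar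
  average_deriv₁ : UniformAverage σ (Metric.closedBall x₀ r)
    (fun ω => deriv₁ (Metric.closedBall x₀ r) (f ω)) (deriv₁ (Metric.closedBall x₀ r) fbar)
  average_deriv₂ : UniformAverage σ (Metric.closedBall x₀ r)
    (fun ω => deriv₂ (Metric.closedBall x₀ r) (f ω)) (deriv₂ (Metric.closedBall x₀ r) fbar)
  stationary : fbar x₀ = 0
  hyperbolic : ∀ s : ℝ, (s : ℂ) * Complex.I ∉ complexSpectrum (fderiv ℝ fbar x₀)

end InvTorus

end

/-! Finding an invariant torus amounts to finding a continuous `u` on the base whose derivative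
along every orbit is `G ω (u ω)`. Minimality and quasi-periodicity then come for free: `ω ↦ (u ω,
ω)` is a homeomorphism of the compact base onto the graph that carries the driving flow to the skew
product. Forward orbits suffice, because in a compact minimal flow they are already dense.

For a hyperbolic linear part, integration against Green's function gives a bounded solution operator
`K` on `C(Ω, E)` with norm at most `2 * N / ν`, and hyperbolicity leaves no other bounded solution.
A quasilinear torus is a fixed point of `u ↦ K (f + F(·, u))`. This map contracts a ball around `γ`
exactly because `L < ν / (2 * N)`, and its radius is `γ₀ / (ν / (2 * N) - L)`. With `ε • F` in place
of `F` the radius is of order `ε`, which yields convergence to `γ`.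

For averaging, let `a` be the derivative of the averaged field at `x₀`. The spectral hypothesis
gives `x' = a x` an exponential dichotomy. Slowing time by `ε` divides the decay rate but multiplies
the forcing, so the solution operators `K ε` of `u' = ε (a u + h)` are bounded uniformly in `ε`.
With `x = x₀ + y` the equation becomes `y = L y + K ε f₀ + K ε (Q y)`, where `L` is `K ε` after
multiplication by the mean-zero family `B = f'(·, x₀) - a`. Primitives along the flow show that `K ε
f₀` tends to `0`. The operator `L` need not be small, but `L * L` is, and this already inverts `1 -
L` with a uniform bound. The remainder `Q` has a small Lipschitz constant near `0`, so a contraction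
argument finishes (`existsUnique_fixedPoint_of_sq_small`).

The dichotomy is obtained without contour integrals. Characters of a commutative Banach algebra show
that the shift minus `exp a` is invertible on bounded two-sided sequences, and the bounded response
to a single impulse contains the projection. -/

namespace InvTorus

/-! ### Differentiation along the orbits of a flow -/

section FlowDerivative

variable {Ω : Type*} [TopologicalSpace Ω]
variable {V : Type*} [NormedAddCommGroup V] [NormedSpace ℝ V]

/-- `v` is the derivative of `u` along the orbits of the flow `σ`. -/
def HasFlowDeriv (σ : Flow ℝ Ω) (u v : Ω → V) : Prop :=
  ∀ ω t, HasDerivAt (fun s => u (σ s ω)) (v (σ t ω)) t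

variable {σ : Flow ℝ Ω} {u v u₁ v₁ : Ω → V}

/-- It suffices to differentiate at one positive time. -/
theorem hasFlowDeriv_of_hasDerivAt_one
    (h : ∀ ω, HasDerivAt (fun s => u (σ s ω)) (v (σ 1 ω)) 1) : HasFlowDeriv σ u v := by
  intro ω t
  have h₁ := h (σ (t - 1) ω)
  rw [← σ.map_add, add_sub_cancel] at h₁
  -- The point `σ t ω` is the time-one point of the orbit started at `σ (t - 1) ω`; the chain rule
  -- with this shift transports the derivative.
  have h₂ : HasDerivAt (fun s : ℝ => s - (t - 1)) 1 t := (hasDerivAt_id t).sub_const _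
  have h₃ := HasDerivAt.scomp (h := fun s : ℝ => s - (t - 1))
    (g₁ := fun s => u (σ s (σ (t - 1) ω))) t (by simpa using h₁) h₂
  simpa [Function.comp_def, ← σ.map_add] using h₃

theorem HasFlowDeriv.sub (h : HasFlowDeriv σ u v) (h₁ : HasFlowDeriv σ u₁ v₁) :
    HasFlowDeriv σ (fun ω => u ω - u₁ ω) (fun ω => v ω - v₁ ω) :=
  fun ω t => (h ω t).sub (h₁ ω t)

theorem HasFlowDeriv.const_smul (c : ℝ) (h : HasFlowDeriv σ u v) :
    HasFlowDeriv σ (fun ω => c • u ω) (fun ω => c • v ω) :=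
  fun ω t => (h ω t).const_smul c

theorem HasFlowDeriv.clm_apply {W : Type*} [NormedAddCommGroup W] [NormedSpace ℝ W]
    {B B' : Ω → V →L[ℝ] W} (hB : HasFlowDeriv σ B B') (h : HasFlowDeriv σ u v) :
    HasFlowDeriv σ (fun ω => B ω (u ω)) (fun ω => B' ω (u ω) + B ω (v ω)) :=
  fun ω t => (hB ω t).clm_apply (h ω t)

theorem HasFlowDeriv.congr (h : HasFlowDeriv σ u v) (hu : ∀ ω, u₁ ω = u ω)
    (hv : ∀ ω, v₁ ω = v ω) : HasFlowDeriv σ u₁ v₁ := by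
  obtain rfl : u₁ = u := funext hu
  obtain rfl : v₁ = v := funext hv
  exact h

end FlowDerivative

/-! ### Invariant tori and their dynamics -/

section Tori

theorem torusGraph_eq_range {Ω E : Type*} [TopologicalSpace Ω] [NormedAddCommGroup E]
    (u : C(Ω, E)) : torusGraph u = range fun ω => (u ω, ω) := by
  ext ⟨x, ω⟩
  simp [torusGraph, eq_comm]

variable {Ω : Type*} [TopologicalSpace Ω]
variable {E : Type*} [NormedAddCommGroup E] [NormedSpace ℝ E]
variable {σ : Flow ℝ Ω} {G : Ω → E → E} {D : Set E} {u : C(Ω, E)}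

theorem isSolution_solutionMap {ω : Ω} {x : E} (h : HasUniqueSolution σ G D ω x) :
    IsSolution σ G D ω (fun t => solutionMap σ G D t x ω) ∧ solutionMap σ G D 0 x ω = x := by
  obtain ⟨y, hy, -⟩ := h
  have hex : ∃ y : ℝ → E, IsSolution σ G D ω y ∧ y 0 = x := ⟨y, hy⟩
  have := hex.choose_spec
  simpa only [solutionMap, dif_pos hex] using this

theorem HasUniqueSolution.eqOn {ω : Ω} {x : E} (h : HasUniqueSolution σ G D ω x) {y z : ℝ → E}
    (hy : IsSolution σ G D ω y) (hy0 : y 0 = x) (hz : IsSolution σ G D ω z) (hz0 : z 0 = x) :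
    EqOn y z (Ici 0) := by
  obtain ⟨w, -, hw⟩ := h
  exact (hw y hy hy0).trans (hw z hz hz0).symm

theorem HasFlowDeriv.isSolution (hu : HasFlowDeriv σ u fun ω => G ω (u ω)) (hD : ∀ ω, u ω ∈ D)
    (ω : Ω) : IsSolution σ G D ω fun t => u (σ t ω) :=
  fun t _ => ⟨hD _, (hu ω t).hasDerivWithinAt⟩

theorem HasFlowDeriv.isInvariantTorus (hu : HasFlowDeriv σ u fun ω => G ω (u ω))
    (hD : ∀ ω, u ω ∈ D) (h : ∀ ω, HasUniqueSolution σ G D ω (u ω)) :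
    IsInvariantTorus σ G D u := fun ω => by
  refine ⟨h ω, fun t ht => ?_⟩
  have hs := isSolution_solutionMap (h ω)
  exact (h ω).eqOn (hu.isSolution hD ω) (by simp [σ.map_zero_apply]) hs.1 hs.2 ht

/-- Invariance only gives information for `t ≥ 0`, where the derivative at `0` is one-sided. Time
one is an interior point, so the derivative there is two-sided, and it can be transported to every
time. -/
theorem IsInvariantTorus.hasFlowDeriv (h : IsInvariantTorus σ G D u) :
    HasFlowDeriv σ u fun ω => G ω (u ω) := by
  refine hasFlowDeriv_of_hasDerivAt_one fun ω => ?_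
  obtain ⟨hω, heq⟩ := h ω
  have hs := ((isSolution_solutionMap hω).1 1 zero_le_one).2
  simp only [← heq 1 zero_le_one] at hs
  exact (hs.congr (fun t ht => heq t ht) (heq 1 zero_le_one)).hasDerivAt (Ici_mem_nhds one_pos)

/-- In a compact minimal flow the forward orbits are dense. -/
theorem closure_forward_orbit_eq_univ [CompactSpace Ω]
    (hmin : IsCompactMinimal univ (fun t ω => σ t ω) univ) (ω : Ω) :
    closure ((fun t => σ t ω) '' Ici 0) = univ := by
  -- By compactness the forward orbit has a limit point `z`. The whole two-sided orbit of `z` lies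
  -- in the closure of the forward orbit, since for each `t` the times `t + s` are eventually
  -- nonnegative; and the orbit of `z` is dense.
  obtain ⟨z, -, hz⟩ := isCompact_univ.exists_mapClusterPt (f := atTop) (u := fun t : ℝ => σ t ω)
    (by simp)
  have hmem : (fun t => σ t z) '' univ ⊆ closure ((fun t => σ t ω) '' Ici 0) := by
    rintro _ ⟨t, -, rfl⟩
    have hc : ContinuousAt (fun x => σ t x) z := (σ.continuous_toFun t).continuousAt
    have h := MapClusterPt.continuousAt_comp hc hz
    refine isClosed_closure.mem_of_mapClusterPt h ?_
    filter_upwards [eventually_ge_atTop (-t)] with s hs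
    refine subset_closure ⟨t + s, ?_, σ.map_add _ _ _⟩
    simp only [mem_Ici]
    linarith
  have := closure_minimal hmem isClosed_closure
  rw [hmin.orbit_closure z (mem_univ z)] at this
  exact univ_subset_iff.1 this

theorem IsInvariantTorus.skewProduct_eq (h : IsInvariantTorus σ G D u) (ω : Ω) {t : ℝ}
    (ht : 0 ≤ t) : skewProduct σ G D t (u ω, ω) = (u (σ t ω), σ t ω) := by
  simp [skewProduct, (h ω).2 t ht]

/-- An invariant torus over a compact minimal quasi-periodic flow is itself compact minimal and
quasi-periodic. -/
theorem IsInvariantTorus.isMinimalQuasiPeriodicTorus [CompactSpace Ω] [T2Space Ω]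
    (h : IsInvariantTorus σ G D u) (hmin : IsCompactMinimal univ (fun t ω => σ t ω) univ)
    (hqp : ∀ ω, IsQuasiPeriodicOn univ (fun t => σ t ω)) :
    IsMinimalQuasiPeriodicTorus σ G D u := by
  have hg : Continuous fun ω => (u ω, ω) := u.continuous.prodMk continuous_id
  refine ⟨h, ⟨?_, ?_, ?_, ?_⟩, ?_⟩
  · obtain ⟨ω, -⟩ := hmin.nonempty
    exact ⟨(u ω, ω), rfl⟩
  · rw [torusGraph_eq_range]
    exact isCompact_range hg
  · intro t ht
    rw [torusGraph_eq_range]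
    refine Subset.antisymm ?_ ?_
    · rintro _ ⟨_, ⟨ω, rfl⟩, rfl⟩
      exact ⟨σ t ω, (h.skewProduct_eq ω ht).symm⟩
    · rintro _ ⟨ω, rfl⟩
      -- The skew product only runs forward, but the base flow runs backward, so the point of the
      -- graph over `σ (-t) ω` is a preimage.
      refine ⟨_, ⟨σ (-t) ω, rfl⟩, ?_⟩
      rw [h.skewProduct_eq _ ht, ← σ.map_add]
      simp [σ.map_zero_apply]
  · intro p hp
    rw [torusGraph_eq_range] at hp ⊢
    obtain ⟨ω, rfl⟩ := hp
    have himg : (fun t => skewProduct σ G D t (u ω, ω)) '' Ici 0 =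
        (fun ω => (u ω, ω)) '' ((fun t => σ t ω) '' Ici 0) := by
      rw [image_image]
      exact image_congr fun t ht => h.skewProduct_eq ω ht
    -- A continuous map from a compact space to a Hausdorff space is closed, so it commutes with
    -- closures.
    rw [himg, hg.isClosedMap.closure_image_eq_of_continuous hg,
      closure_forward_orbit_eq_univ hmin, image_univ]
  · intro p hp
    rw [torusGraph_eq_range] at hp
    obtain ⟨ω, rfl⟩ := hp
    obtain ⟨k, ν, Ψ, hν, hΨ⟩ := hqp ω
    refine ⟨k, ν, (⟨_, hg⟩ : C(Ω, E × Ω)).comp Ψ, hν, fun t ht => ?_⟩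
    have hΨt : σ t ω = Ψ _ := hΨ t (mem_univ t)
    simp only [h.skewProduct_eq ω ht, hΨt]
    rfl

end Tori

end InvTorus

namespace InvTorus

/-! ### The Cauchy operator: cocycle property, inverse, continuity in the base point -/

section Cauchy

variable {Ω : Type*} [TopologicalSpace Ω]
variable {E : Type*} [NormedAddCommGroup E] [NormedSpace ℝ E]
variable {σ : Flow ℝ Ω} {A : C(Ω, E →L[ℝ] E)} {U : ℝ → Ω → E →L[ℝ] E}

theorem IsCauchyOperator.continuous_time (hU : IsCauchyOperator σ A U) (ω : Ω) : Continuous fun t => U t ω :=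
  continuous_iff_continuousAt.2 fun t => (hU.hasDerivAt t ω).continuousAt

variable [CompactSpace Ω]

theorem lipschitzWith_mul_left (ω : Ω) :
    LipschitzWith ‖A‖₊ fun X : E →L[ℝ] E => A ω * X := by
  refine LipschitzWith.of_dist_le_mul fun X Y => ?_
  rw [dist_eq_norm, dist_eq_norm, ← mul_sub]
  exact (norm_mul_le _ _).trans (mul_le_mul_of_nonneg_right (A.norm_coe_le_norm ω) (norm_nonneg _))

theorem lipschitzWith_apply (ω : Ω) : LipschitzWith ‖A‖₊ fun x : E => A ω x := by
  refine LipschitzWith.of_dist_le_mul fun x y => ?_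
  rw [dist_eq_norm, dist_eq_norm, ← map_sub]
  exact (A ω).le_of_opNorm_le (A.norm_coe_le_norm ω) _

namespace IsCauchyOperator

theorem map_add (hU : IsCauchyOperator σ A U) (t s : ℝ) (ω : Ω) :
    U (t + s) ω = U t (σ s ω) * U s ω := by
  have h : (fun t => U (t + s) ω) = fun t => U t (σ s ω) * U s ω := by
    refine ODE_solution_unique_univ (t₀ := 0) (s := fun _ => univ)
      (v := fun t X => A (σ (t + s) ω) * X) (K := ‖A‖₊)
      (fun t => (lipschitzWith_mul_left _).lipschitzOnWith) (fun t => ⟨?_, mem_univ _⟩)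
      (fun t => ⟨?_, mem_univ _⟩) (by simp [hU.map_zero])
    · exact (hU.hasDerivAt (t + s) ω).comp_add_const t s
    · have := (hU.hasDerivAt t (σ s ω)).mul_const (U s ω)
      rwa [mul_assoc, ← σ.map_add] at this
  exact congrFun h t

theorem mul_neg (hU : IsCauchyOperator σ A U) (t : ℝ) (ω : Ω) :
    U t ω * U (-t) (σ t ω) = 1 := by
  have h := hU.map_add t (-t) (σ t ω)
  rw [add_neg_cancel, hU.map_zero, ← σ.map_add, neg_add_cancel, σ.map_zero_apply] at h
  exact h.symm

theorem neg_mul (hU : IsCauchyOperator σ A U) (t : ℝ) (ω : Ω) :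
    U (-t) (σ t ω) * U t ω = 1 := by
  rw [← hU.map_add, neg_add_cancel, hU.map_zero]

theorem isUnit (hU : IsCauchyOperator σ A U) (t : ℝ) (ω : Ω) : IsUnit (U t ω) :=
  ⟨⟨_, _, hU.mul_neg t ω, hU.neg_mul t ω⟩, rfl⟩

theorem inverse_eq (hU : IsCauchyOperator σ A U) (t : ℝ) (ω : Ω) :
    Ring.inverse (U t ω) = U (-t) (σ t ω) :=
  Ring.inverse_unit (⟨_, _, hU.mul_neg t ω, hU.neg_mul t ω⟩ : (E →L[ℝ] E)ˣ)

theorem inverse_sub (hU : IsCauchyOperator σ A U) (s t : ℝ) (ω : Ω) :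
    Ring.inverse (U (s - t) (σ t ω)) = U t ω * Ring.inverse (U s ω) := by
  rw [hU.inverse_eq, hU.inverse_eq, ← σ.map_add, sub_add_cancel, neg_sub, sub_eq_add_neg,
    hU.map_add, ← σ.map_add, neg_add_cancel, σ.map_zero_apply]

/-- A vector solution is the image of its initial value under the Cauchy operator. -/
theorem eq_apply (hU : IsCauchyOperator σ A U) {ω : Ω} {y : ℝ → E}
    (hy : ∀ t, HasDerivAt y (A (σ t ω) (y t)) t) (t : ℝ) : y t = U t ω (y 0) := by
  have h : y = fun t => U t ω (y 0) := by
    refine ODE_solution_unique_univ (t₀ := 0) (s := fun _ => univ)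
      (v := fun t x => A (σ t ω) x) (K := ‖A‖₊)
      (fun t => (lipschitzWith_apply _).lipschitzOnWith) (fun t => ⟨hy t, mem_univ _⟩)
      (fun t => ⟨?_, mem_univ _⟩) (by simp [hU.map_zero])
    simpa using (hU.hasDerivAt t ω).clm_apply (hasDerivAt_const t (y 0))
  exact congrFun h t

/-- Grönwall's inequality: on `[0, t]` the curve `U s ω` solves the equation over a nearby `ω'` up
to an error `η * C`, where `C` bounds `U s ω` and `η` bounds the difference of the coefficients
along the two orbits. Compactness of `[0, t]` makes `η` as small as desired near `ω`. -/
theorem continuous_of_nonneg (hU : IsCauchyOperator σ A U) {t : ℝ} (ht : 0 ≤ t) :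
    Continuous fun ω => U t ω := by
  refine continuous_iff_continuousAt.2 fun ω => ?_
  obtain ⟨C, hC⟩ := (isCompact_Icc (a := 0) (b := t)).exists_bound_of_continuousOn
    (hU.continuous_time ω).continuousOn
  have hC0 : 0 ≤ C := (norm_nonneg _).trans (hC 0 ⟨le_rfl, ht⟩)
  have hlim : Tendsto (fun η : ℝ => gronwallBound 0 ‖A‖₊ (0 + η * C) t) (𝓝 0) (𝓝 0) := by
    have hc : Continuous fun η : ℝ => gronwallBound 0 ‖A‖₊ (0 + η * C) t :=
      (gronwallBound_continuous_ε _ _ _).comp (by fun_prop)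
    simpa [gronwallBound_ε0_δ0] using hc.tendsto 0
  rw [Metric.continuousAt_iff']
  intro ε hε
  obtain ⟨η, hηlt, hη⟩ : ∃ η : ℝ, gronwallBound 0 ‖A‖₊ (0 + η * C) t < ε ∧ 0 < η :=
    (((hlim.mono_left nhdsWithin_le_nhds).eventually (gt_mem_nhds hε)).and
      (self_mem_nhdsWithin : Ioi (0 : ℝ) ∈ 𝓝[>] 0)).exists
  have hev : ∀ᶠ ω' in 𝓝 ω, ∀ s ∈ Icc 0 t, dist (A (σ s ω)) (A (σ s ω')) < η := by
    refine isCompact_Icc.eventually_forall_of_forall_eventually fun s _ => ?_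
    have hcont : Continuous fun p : Ω × ℝ => dist (A (σ p.2 ω)) (A (σ p.2 p.1)) :=
      (A.continuous.comp (σ.continuous continuous_snd continuous_const)).dist
        (A.continuous.comp (σ.continuous continuous_snd continuous_fst))
    exact hcont.continuousAt.eventually (gt_mem_nhds (by simpa using hη))
  filter_upwards [hev] with ω' hω'
  refine lt_of_le_of_lt ?_ hηlt
  have := dist_le_of_approx_trajectories_ODE (v := fun s X => A (σ s ω') * X) (K := ‖A‖₊)
    (f := fun s => U s ω') (f' := fun s => A (σ s ω') * U s ω') (g := fun s => U s ω)
    (g' := fun s => A (σ s ω) * U s ω) (a := 0) (b := t) (δ := 0) (εf := 0) (εg := η * C)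
    (fun s => lipschitzWith_mul_left _) (hU.continuous_time ω').continuousOn
    (fun s _ => (hU.hasDerivAt s ω').hasDerivWithinAt) (fun s _ => by simp)
    (hU.continuous_time ω).continuousOn
    (fun s _ => (hU.hasDerivAt s ω).hasDerivWithinAt) (fun s hs => ?_)
    (by simp [hU.map_zero]) t ⟨ht, le_rfl⟩
  · simpa using this
  · rw [dist_eq_norm, ← sub_mul]
    refine (norm_mul_le _ _).trans (mul_le_mul ?_ (hC s ⟨hs.1, hs.2.le⟩) (norm_nonneg _) hη.le)
    rw [← dist_eq_norm]
    exact (hω' s ⟨hs.1, hs.2.le⟩).le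

variable [CompleteSpace E]

theorem continuous_inverse_time (hU : IsCauchyOperator σ A U) (ω : Ω) :
    Continuous fun t => Ring.inverse (U t ω) := by
  refine continuous_iff_continuousAt.2 fun t => ?_
  obtain ⟨x, hx⟩ := hU.isUnit t ω
  have h := NormedRing.inverse_continuousAt x
  rw [hx] at h
  exact h.comp (f := fun t => U t ω) (hU.continuous_time ω).continuousAt

theorem continuous_inverse (hU : IsCauchyOperator σ A U) (t : ℝ) :
    Continuous fun ω => Ring.inverse (U t ω) := by
  rcases le_total 0 t with ht | ht
  · refine continuous_iff_continuousAt.2 fun ω => ?_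
    obtain ⟨x, hx⟩ := hU.isUnit t ω
    have h := NormedRing.inverse_continuousAt x
    rw [hx] at h
    exact h.comp (f := fun ω => U t ω) (hU.continuous_of_nonneg ht).continuousAt
  · simp only [hU.inverse_eq]
    exact (hU.continuous_of_nonneg (neg_nonneg.2 ht)).comp (σ.continuous_toFun t)

end IsCauchyOperator

end Cauchy

end InvTorus

namespace InvTorus

/-! ### Hyperbolic linear equations and the bounded solution operator -/

section LinearTorus

open MeasureTheory

theorem integrable_exp_neg_mul_abs {ν : ℝ} (hν : 0 < ν) :
    Integrable fun τ : ℝ => Real.exp (-ν * |τ|) := by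
  rw [← integrableOn_univ, ← Iic_union_Ioi (a := (0 : ℝ))]
  refine IntegrableOn.union ?_ ?_
  · refine (integrableOn_exp_mul_Iic hν 0).congr_fun (fun τ hτ => ?_) measurableSet_Iic
    simp [abs_of_nonpos (mem_Iic.1 hτ)]
  · refine (integrableOn_exp_mul_Ioi (neg_neg_of_pos hν) 0).congr_fun (fun τ hτ => ?_)
      measurableSet_Ioi
    simp [abs_of_pos (mem_Ioi.1 hτ)]

theorem integral_exp_neg_mul_abs {ν : ℝ} (hν : 0 < ν) :
    ∫ τ : ℝ, Real.exp (-ν * |τ|) = 2 / ν := by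
  rw [integral_comp_abs (f := fun τ => Real.exp (-ν * τ)), integral_exp_mul_Ioi (neg_neg_of_pos hν)]
  simp [div_eq_mul_inv]

variable {Ω : Type*} [TopologicalSpace Ω]
variable {E : Type*} [NormedAddCommGroup E] [NormedSpace ℝ E]
variable {σ : Flow ℝ Ω} {A P : C(Ω, E →L[ℝ] E)} {U : ℝ → Ω → E →L[ℝ] E} {N ν : ℝ}

namespace IsHyperbolic

theorem green_zero (hU : IsHyperbolic σ A U P N ν) (τ : ℝ) (ω : Ω) :
    green U P 0 τ ω = if τ < 0 then P ω * Ring.inverse (U τ ω)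
      else -((1 - P ω) * Ring.inverse (U τ ω)) := by
  simp [green, hU.isCauchyOperator.map_zero]

theorem norm_green_le (hU : IsHyperbolic σ A U P N ν) (τ : ℝ) (ω : Ω) :
    ‖green U P 0 τ ω‖ ≤ N * Real.exp (-ν * |τ|) := by
  unfold green
  split_ifs with h
  · simpa [abs_of_neg h] using hU.stable 0 τ ω h.le
  · have h := not_lt.1 h
    rw [norm_neg]
    simpa [abs_of_nonneg h] using hU.unstable 0 τ ω h

variable [CompactSpace Ω]

theorem norm_green_apply_le (hU : IsHyperbolic σ A U P N ν) (h : C(Ω, E)) (τ : ℝ) (ω : Ω) :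
    ‖green U P 0 τ ω (h (σ τ ω))‖ ≤ N * ‖h‖ * Real.exp (-ν * |τ|) := by
  calc ‖green U P 0 τ ω (h (σ τ ω))‖ ≤ N * Real.exp (-ν * |τ|) * ‖h‖ :=
        (green U P 0 τ ω).le_of_opNorm_le_of_le (hU.norm_green_le τ ω) (h.norm_coe_le_norm _)
    _ = _ := by ring

/-- A hyperbolic homogeneous equation has no nontrivial bounded solutions. -/
theorem eq_zero_of_hasFlowDeriv (hU : IsHyperbolic σ A U P N ν) {d : C(Ω, E)}
    (hd : HasFlowDeriv σ d fun ω => A ω (d ω)) : d = 0 := by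
  have hC := hU.isCauchyOperator
  have key : ∀ t ω, d (σ t ω) = U t ω (d ω) := fun t ω => by
    simpa [σ.map_zero_apply] using hC.eq_apply (y := fun t => d (σ t ω)) (hd ω) t
  have hlim : Tendsto (fun t => N * Real.exp (-ν * t) * ‖d‖) atTop (𝓝 0) := by
    have h1 : Tendsto (fun t => -ν * t) atTop atBot :=
      tendsto_id.const_mul_atTop_of_neg (neg_neg_of_pos hU.ν_pos)
    simpa using ((Real.tendsto_exp_atBot.comp h1).const_mul N).mul_const ‖d‖
  ext ω
  -- The stable component at `ω` is the image of the one at `σ (-t) ω` under a contraction of size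
  -- `N * exp (-ν * t)`, and `d` is bounded; let `t → ∞`. The unstable component is treated in the
  -- same way from the future point `σ t ω`.
  have hs : P ω (d ω) = 0 := by
    refine norm_le_zero_iff.1 (ge_of_tendsto hlim ?_)
    filter_upwards [eventually_ge_atTop 0] with t ht
    have h1 : P ω (d ω) = (U t (σ (-t) ω) * P (σ (-t) ω)) (d (σ (-t) ω)) := by
      rw [hU.commute, mul_apply_eq_comp, ← key, ← σ.map_add]
      simp [σ.map_zero_apply]
    have h2 := hU.stable t 0 (σ (-t) ω) ht
    rw [hC.map_zero, Ring.inverse_one, mul_one, sub_zero] at h2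
    rw [h1]
    exact ContinuousLinearMap.le_of_opNorm_le_of_le _ h2 (d.norm_coe_le_norm _)
  have hu : (1 - P ω) (d ω) = 0 := by
    refine norm_le_zero_iff.1 (ge_of_tendsto hlim ?_)
    filter_upwards [eventually_ge_atTop 0] with t ht
    have h1 : (1 - P ω) (d ω) = (U (-t) (σ t ω) * (1 - P (σ t ω))) (d (σ t ω)) := by
      have h3 : U (-t) (σ t ω) * (1 - P (σ t ω)) = (1 - P ω) * U (-t) (σ t ω) := by
        rw [mul_sub, hU.commute, mul_one, sub_mul, one_mul, ← σ.map_add, neg_add_cancel,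
          σ.map_zero_apply]
      rw [h3, mul_apply_eq_comp, ← key, ← σ.map_add, neg_add_cancel, σ.map_zero_apply]
    have h2 := hU.unstable (-t) 0 (σ t ω) (by linarith)
    rw [hC.map_zero, Ring.inverse_one, mul_one, sub_zero, mul_neg, ← neg_mul] at h2
    rw [h1]
    exact ContinuousLinearMap.le_of_opNorm_le_of_le _ h2 (d.norm_coe_le_norm _)
  rw [sub_apply, hs, sub_zero] at hu
  exact hu

/-- The kernel is dominated by `N * exp (-ν * |τ|)`, whose integral is `2 * N / ν`. This is the
source of the threshold `ν / (2 * N)` for the Lipschitz constant. -/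
theorem norm_linearTorus_le (hU : IsHyperbolic σ A U P N ν) (h : C(Ω, E)) (ω : Ω) :
    ‖linearTorus σ U P h ω‖ ≤ 2 * N / ν * ‖h‖ := by
  refine (norm_integral_le_of_norm_le ((integrable_exp_neg_mul_abs hU.ν_pos).const_mul (N * ‖h‖))
    (Eventually.of_forall fun τ => hU.norm_green_apply_le h τ ω)).trans_eq ?_
  rw [integral_const_mul, integral_exp_neg_mul_abs hU.ν_pos]
  ring

variable [CompleteSpace E]

theorem continuous_green (hU : IsHyperbolic σ A U P N ν) (τ : ℝ) :
    Continuous fun ω => green U P 0 τ ω := by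
  have hc := hU.isCauchyOperator.continuous_inverse τ
  simp only [hU.green_zero]
  split_ifs
  · exact P.continuous.mul hc
  · exact ((continuous_const.sub P.continuous).mul hc).neg

theorem aestronglyMeasurable_green (hU : IsHyperbolic σ A U P N ν) (h : C(Ω, E)) (ω : Ω) :
    AEStronglyMeasurable (fun τ => green U P 0 τ ω (h (σ τ ω))) volume := by
  have hc := hU.isCauchyOperator.continuous_inverse_time ω
  have hh : Continuous fun τ => h (σ τ ω) :=
    h.continuous.comp (σ.continuous continuous_id continuous_const)
  have heq : (fun τ => green U P 0 τ ω (h (σ τ ω))) = fun τ =>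
      if τ ∈ Iio (0 : ℝ) then (P ω * Ring.inverse (U τ ω)) (h (σ τ ω))
      else (-((1 - P ω) * Ring.inverse (U τ ω))) (h (σ τ ω)) := by
    funext τ
    rw [hU.green_zero]
    simp only [mem_Iio]
    split_ifs <;> rfl
  rw [heq]
  exact (StronglyMeasurable.ite measurableSet_Iio
    ((continuous_const.mul hc).clm_apply hh).stronglyMeasurable
    ((continuous_const.mul hc).neg.clm_apply hh).stronglyMeasurable).aestronglyMeasurable

theorem integrable_green (hU : IsHyperbolic σ A U P N ν) (h : C(Ω, E)) (ω : Ω) :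
    Integrable fun τ => green U P 0 τ ω (h (σ τ ω)) :=
  ((integrable_exp_neg_mul_abs hU.ν_pos).const_mul (N * ‖h‖)).mono'
    (hU.aestronglyMeasurable_green h ω) (Eventually.of_forall fun τ => hU.norm_green_apply_le h τ ω)

theorem continuous_linearTorus [FirstCountableTopology Ω] (hU : IsHyperbolic σ A U P N ν) (h : C(Ω, E)) :
    Continuous (linearTorus σ U P h) :=
  continuous_iff_continuousAt.2 fun _ =>
    continuousAt_of_dominated (Eventually.of_forall fun ω' => hU.aestronglyMeasurable_green h ω')
      (Eventually.of_forall fun ω' => Eventually.of_forall fun τ => hU.norm_green_apply_le h τ ω')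
      ((integrable_exp_neg_mul_abs hU.ν_pos).const_mul (N * ‖h‖))
      (Eventually.of_forall fun τ => ((hU.continuous_green τ).clm_apply
        (h.continuous.comp (σ.continuous_toFun τ))).continuousAt)

/-- Variation of constants for the bounded solution of the inhomogeneous linear equation. -/
theorem linearTorus_flow (hU : IsHyperbolic σ A U P N ν) (h : C(Ω, E)) (ω : Ω) {t : ℝ}
    (ht : 0 ≤ t) : linearTorus σ U P h (σ t ω) =
      U t ω (linearTorus σ U P h ω + ∫ s in (0 : ℝ)..t, Ring.inverse (U s ω) (h (σ s ω))) := by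
  have hC := hU.isCauchyOperator
  have hcont : Continuous fun s => Ring.inverse (U s ω) (h (σ s ω)) :=
    (hC.continuous_inverse_time ω).clm_apply
      (h.continuous.comp (σ.continuous continuous_id continuous_const))
  have hint : Integrable ((Ico 0 t).indicator fun s => Ring.inverse (U s ω) (h (σ s ω))) :=
    (integrable_indicator_iff measurableSet_Ico).2
      ((hcont.integrableOn_Icc).mono_set Ico_subset_Icc_self)
  -- Moving the base point to `σ t ω` multiplies the kernel by `U t ω`, except for `s ∈ [0, t)`.
  -- There the branch changes from `-(1 - P)` to `P`, and the jump is the identity; this produces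
  -- the integral over `[0, t]`.
  have hpt : ∀ s, green U P 0 (s - t) (σ t ω) (h (σ (s - t) (σ t ω))) =
      U t ω (green U P 0 s ω (h (σ s ω)) +
        (Ico 0 t).indicator (fun s => Ring.inverse (U s ω) (h (σ s ω))) s) := by
    intro s
    rw [← σ.map_add, sub_add_cancel, hU.green_zero, hU.green_zero, hC.inverse_sub, ← mul_assoc,
      ← mul_assoc, sub_mul, ← hU.commute, one_mul]
    by_cases h1 : s < 0
    · have h2 : s - t < 0 := by linarith
      simp [h1, h2, not_le.2 h1, indicator]
    · have h1' := not_lt.1 h1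
      by_cases h2 : s < t
      · have h3 : s - t < 0 := by linarith
        simp [h1, h1', h2, h3, indicator]
      · simp [h1, h1', h2, indicator]
  have hsh := integral_sub_right_eq_self
    (fun s => green U P 0 s (σ t ω) (h (σ s (σ t ω)))) (μ := volume) t
  unfold linearTorus
  rw [← hsh]
  simp only [hpt]
  have hcomm := ContinuousLinearMap.integral_comp_comm (U t ω) ((hU.integrable_green h ω).add hint)
  simp only [Pi.add_apply] at hcomm
  rw [hcomm, integral_add (hU.integrable_green h ω) hint, integral_indicator measurableSet_Ico,
    intervalIntegral.integral_of_le ht, integral_Ico_eq_integral_Ioc]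

theorem hasFlowDeriv_linearTorus (hU : IsHyperbolic σ A U P N ν) (h : C(Ω, E)) :
    HasFlowDeriv σ (linearTorus σ U P h) fun ω => A ω (linearTorus σ U P h ω) + h ω := by
  refine hasFlowDeriv_of_hasDerivAt_one fun ω => ?_
  have hC := hU.isCauchyOperator
  have hcont : Continuous fun s => Ring.inverse (U s ω) (h (σ s ω)) :=
    (hC.continuous_inverse_time ω).clm_apply
      (h.continuous.comp (σ.continuous continuous_id continuous_const))
  -- The formula of `linearTorus_flow` is available for `t ≥ 0` only, and time one is interior to
  -- that range.
  have hd := (hC.hasDerivAt 1 ω).clm_apply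
    ((intervalIntegral.integral_hasDerivAt_right (hcont.intervalIntegrable 0 1)
      (hcont.stronglyMeasurableAtFilter _ _) hcont.continuousAt).const_add (linearTorus σ U P h ω))
  have hinv : ∀ x, U 1 ω (Ring.inverse (U 1 ω) x) = x := fun x =>
    DFunLike.congr_fun (Ring.mul_inverse_cancel _ (hC.isUnit 1 ω)) x
  rw [mul_apply_eq_comp, ← hU.linearTorus_flow h ω zero_le_one, hinv] at hd
  refine hd.congr_of_eventuallyEq ?_
  filter_upwards [lt_mem_nhds one_pos] with t ht
  exact hU.linearTorus_flow h ω ht.le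

variable [FirstCountableTopology Ω]

/-- The bounded solution operator of the inhomogeneous linear equation. -/
noncomputable def boundedSolution (hU : IsHyperbolic σ A U P N ν) : C(Ω, E) →L[ℝ] C(Ω, E) :=
  LinearMap.mkContinuous
    { toFun := fun h => ⟨linearTorus σ U P h, hU.continuous_linearTorus h⟩
      map_add' := fun h k => by
        ext ω
        simp only [ContinuousMap.coe_mk, ContinuousMap.add_apply, linearTorus, _root_.map_add]
        exact integral_add (hU.integrable_green h ω) (hU.integrable_green k ω)
      map_smul' := fun c h => by
        ext ω
        simp only [ContinuousMap.coe_mk, ContinuousMap.smul_apply, linearTorus, _root_.map_smul,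
          RingHom.id_apply]
        exact integral_smul c _ }
    (2 * N / ν) fun h => by
      have := hU.N_pos
      have := hU.ν_pos
      exact (ContinuousMap.norm_le _ (by positivity)).2 fun ω => hU.norm_linearTorus_le h ω

theorem boundedSolution_apply (hU : IsHyperbolic σ A U P N ν) (h : C(Ω, E)) (ω : Ω) :
    hU.boundedSolution h ω = linearTorus σ U P h ω := rfl

theorem norm_boundedSolution_le (hU : IsHyperbolic σ A U P N ν) :
    ‖hU.boundedSolution‖ ≤ 2 * N / ν := by
  have := hU.N_pos
  have := hU.ν_pos
  exact LinearMap.mkContinuous_norm_le _ (by positivity) _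

theorem hasFlowDeriv_boundedSolution (hU : IsHyperbolic σ A U P N ν) (h : C(Ω, E)) :
    HasFlowDeriv σ (hU.boundedSolution h) fun ω => A ω (hU.boundedSolution h ω) + h ω :=
  hU.hasFlowDeriv_linearTorus h

theorem eq_boundedSolution (hU : IsHyperbolic σ A U P N ν) {u h : C(Ω, E)}
    (hu : HasFlowDeriv σ u fun ω => A ω (u ω) + h ω) : u = hU.boundedSolution h := by
  refine sub_eq_zero.1 (hU.eq_zero_of_hasFlowDeriv ?_)
  refine (hu.sub (hU.hasFlowDeriv_boundedSolution h)).congr (fun _ => rfl) fun ω => ?_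
  simp

end IsHyperbolic

end LinearTorus

end InvTorus

/-! ### Contraction on a ball and quasilinear equations -/

namespace InvTorus

/-- The contraction principle on a closed ball. -/
theorem existsUnique_fixedPoint_closedBall {X : Type*} [MetricSpace X] [CompleteSpace X]
    {S : X → X} {c : X} {ρ q : ℝ} (hρ : 0 ≤ ρ) (hq0 : 0 ≤ q) (hq1 : q < 1)
    (hmaps : MapsTo S (Metric.closedBall c ρ) (Metric.closedBall c ρ))
    (hlip : ∀ u ∈ Metric.closedBall c ρ, ∀ v ∈ Metric.closedBall c ρ,
      dist (S u) (S v) ≤ q * dist u v) :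
    ∃! u, u ∈ Metric.closedBall c ρ ∧ S u = u := by
  have hK : ContractingWith ⟨q, hq0⟩ (hmaps.restrict S _ _) :=
    ⟨hq1, LipschitzWith.of_dist_le_mul fun u v => hlip u u.2 v v.2⟩
  obtain ⟨u, hu, hfix, -⟩ := hK.exists_fixedPoint' Metric.isClosed_closedBall.isComplete hmaps
    (Metric.mem_closedBall_self hρ) (edist_ne_top _ _)
  refine ⟨u, ⟨hu, hfix⟩, fun v hv => ?_⟩
  have h := hlip v hv.1 u hu
  rw [hv.2, hfix.eq] at h
  have h0 := dist_nonneg (x := v) (y := u)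
  exact dist_le_zero.1 (by nlinarith)

theorem mem_tube {Ω E : Type*} [NormedAddCommGroup E] {γ : Ω → E} {r : ℝ} {ω : Ω} {x : E}
    (h : ‖x - γ ω‖ ≤ r) : x ∈ tube γ r :=
  (Metric.infDist_le_dist_of_mem (mem_range_self ω)).trans (by rwa [dist_eq_norm])

section Quasilinear

variable {Ω : Type*} [TopologicalSpace Ω] [CompactSpace Ω] [FirstCountableTopology Ω]
variable {E : Type*} [NormedAddCommGroup E] [NormedSpace ℝ E] [CompleteSpace E]
variable {σ : Flow ℝ Ω} {A P : C(Ω, E →L[ℝ] E)} {U : ℝ → Ω → E →L[ℝ] E} {N ν : ℝ}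

/-- A quasilinear perturbation of a hyperbolic equation has a bounded solution close to that of the
unperturbed equation. -/
theorem IsHyperbolic.exists_hasFlowDeriv_quasilinear (hU : IsHyperbolic σ A U P N ν)
    {f : C(Ω, E)} {F : C(Ω × E, E)} {L r : ℝ} (hL0 : 0 ≤ L) (hL : L < ν / (2 * N))
    (hr : (⨆ ω, ‖F (ω, linearTorus σ U P f ω)‖) / (ν / (2 * N) - L) ≤ r)
    (hF : LipschitzInSpace F (tube (linearTorus σ U P f) r) L) :
    ∃ u : C(Ω, E), HasFlowDeriv σ u (fun ω => quasilinear A f F ω (u ω)) ∧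
      ∀ ω, ‖u ω - linearTorus σ U P f ω‖ ≤
        (⨆ ω, ‖F (ω, linearTorus σ U P f ω)‖) / (ν / (2 * N) - L) := by
  have hN := hU.N_pos
  have hν := hU.ν_pos
  set γ : C(Ω, E) := hU.boundedSolution f with hγ
  have hγω : ∀ ω, linearTorus σ U P f ω = γ ω := fun ω => (hU.boundedSolution_apply f ω).symm
  have hγ' : linearTorus σ U P f = γ := funext hγω
  simp only [hγ'] at hr hF ⊢
  set g₀ : ℝ := ⨆ ω, ‖F (ω, γ ω)‖ with hg₀
  set ρ : ℝ := g₀ / (ν / (2 * N) - L) with hρ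
  have hpos : 0 < ν / (2 * N) - L := sub_pos.2 hL
  let Fu : C(Ω, E) → C(Ω, E) := fun u => F.comp ((ContinuousMap.id Ω).prodMk u)
  have hFu : ∀ u ω, Fu u ω = F (ω, u ω) := fun _ _ => rfl
  have hg₀0 : 0 ≤ g₀ := Real.iSup_nonneg fun _ => norm_nonneg _
  have hρ0 : 0 ≤ ρ := div_nonneg hg₀0 hpos.le
  have hbdd : BddAbove (range fun ω => ‖F (ω, γ ω)‖) :=
    ⟨‖Fu γ‖, by rintro _ ⟨ω, rfl⟩; exact (Fu γ).norm_coe_le_norm ω⟩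
  have htube : ∀ u ∈ Metric.closedBall γ ρ, ∀ ω, u ω ∈ tube γ r := fun u hu ω => by
    refine mem_tube (ω := ω) (le_trans ?_ hr)
    rw [← dist_eq_norm]
    exact (ContinuousMap.dist_apply_le_dist ω).trans (Metric.mem_closedBall.1 hu)
  have hγball : γ ∈ Metric.closedBall γ ρ := Metric.mem_closedBall_self hρ0
  have hlip : ∀ u ∈ Metric.closedBall γ ρ, ∀ v ∈ Metric.closedBall γ ρ,
      ‖Fu u - Fu v‖ ≤ L * ‖u - v‖ := fun u hu v hv => by
    refine (ContinuousMap.norm_le _ (by positivity)).2 fun ω => ?_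
    refine (hF ω _ (htube u hu ω) _ (htube v hv ω)).trans ?_
    exact mul_le_mul_of_nonneg_left ((u - v).norm_coe_le_norm ω) hL0
  have hK : ∀ h, ‖hU.boundedSolution h‖ ≤ 2 * N / ν * ‖h‖ := fun h =>
    hU.boundedSolution.le_of_opNorm_le hU.norm_boundedSolution_le h
  -- On the ball, `F(·, u)` is bounded by `g₀ + L * ρ`. This identity, which determines `ρ`, says
  -- that the ball is mapped into itself.
  have hρeq : 2 * N / ν * (g₀ + L * ρ) = ρ := by
    have : g₀ = ρ * (ν / (2 * N) - L) := (div_mul_cancel₀ _ hpos.ne').symm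
    rw [this]
    field_simp
    ring
  obtain ⟨u, ⟨hu, hfix⟩, -⟩ := existsUnique_fixedPoint_closedBall
    (S := fun u => hU.boundedSolution (f + Fu u)) (c := γ) (q := 2 * N / ν * L) hρ0
    (by positivity) (by rw [lt_div_iff₀ (by positivity)] at hL; field_simp; linarith)
    (fun u hu => by
      rw [Metric.mem_closedBall, dist_eq_norm] at hu ⊢
      have h1 : ‖Fu u‖ ≤ g₀ + L * ρ := by
        have h2 := hlip u (by rwa [Metric.mem_closedBall, dist_eq_norm]) γ hγball
        have h3 : ‖Fu γ‖ ≤ g₀ :=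
          (ContinuousMap.norm_le _ hg₀0).2 fun ω => le_ciSup hbdd ω
        have h4 := norm_add_le (Fu u - Fu γ) (Fu γ)
        rw [sub_add_cancel] at h4
        have h5 := mul_le_mul_of_nonneg_left hu hL0
        linarith
      dsimp only
      rw [map_add, ← hγ, add_sub_cancel_left]
      exact (hK _).trans ((mul_le_mul_of_nonneg_left h1 (by positivity)).trans_eq hρeq))
    (fun u hu v hv => by
      rw [dist_eq_norm, dist_eq_norm, ← map_sub, add_sub_add_left_eq_sub, mul_assoc]
      exact (hK _).trans (mul_le_mul_of_nonneg_left (hlip u hu v hv) (by positivity)))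
  refine ⟨u, ?_, fun ω => ?_⟩
  · have h := hU.hasFlowDeriv_boundedSolution (f + Fu u)
    rw [hfix] at h
    exact h.congr (fun _ => rfl) fun ω => by simp [quasilinear, hFu, add_assoc]
  · rw [← dist_eq_norm]
    exact (ContinuousMap.dist_apply_le_dist ω).trans (Metric.mem_closedBall.1 hu)

/-- The distance to `γ` is kept in the conclusion because it governs the limit `ε → 0` for the
perturbed equation. -/
theorem IsHyperbolic.exists_torus_quasilinear [T2Space Ω]
    (hmin : IsCompactMinimal univ (fun t ω => σ t ω) univ)
    (hqp : ∀ ω, IsQuasiPeriodicOn univ (fun t => σ t ω)) (hU : IsHyperbolic σ A U P N ν)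
    {f : C(Ω, E)} {F : C(Ω × E, E)} {L r : ℝ} (hL0 : 0 ≤ L) (hL : L < ν / (2 * N))
    (hr : (⨆ ω, ‖F (ω, linearTorus σ U P f ω)‖) / (ν / (2 * N) - L) ≤ r)
    (hF : LipschitzInSpace F (tube (linearTorus σ U P f) r) L)
    (huniq : ∀ ω x, HasUniqueSolution σ (quasilinear A f F) univ ω x) :
    ∃ u : C(Ω, E), IsMinimalQuasiPeriodicTorus σ (quasilinear A f F) univ u ∧
      ∀ ω, ‖u ω - linearTorus σ U P f ω‖ ≤
        (⨆ ω, ‖F (ω, linearTorus σ U P f ω)‖) / (ν / (2 * N) - L) := by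
  obtain ⟨u, hu, hb⟩ := hU.exists_hasFlowDeriv_quasilinear hL0 hL hr hF
  exact ⟨u, (hu.isInvariantTorus (fun _ => mem_univ _)
    fun ω => huniq ω _).isMinimalQuasiPeriodicTorus hmin hqp, hb⟩

/-- For a small parameter, the perturbed quasilinear equation has invariant tori that depend
continuously on the parameter at zero. -/
theorem IsHyperbolic.exists_torus_family [T2Space Ω]
    (hmin : IsCompactMinimal univ (fun t ω => σ t ω) univ)
    (hqp : ∀ ω, IsQuasiPeriodicOn univ (fun t => σ t ω)) (hU : IsHyperbolic σ A U P N ν)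
    {f : C(Ω, E)} {F : C(Ω × E, E)} {L r ε₀ : ℝ} (hL : 0 < L) (hr : 0 < r) (hε₀ : 0 < ε₀)
    (hF : LipschitzInSpace F (tube (linearTorus σ U P f) r) L)
    (huniq : ∀ ε ∈ Icc 0 ε₀, ∀ ω x, HasUniqueSolution σ (quasilinear A f (ε • F)) univ ω x) :
    ∃ ε₁ ∈ Ioc 0 ε₀, ∃ u : ℝ → C(Ω, E),
      (∀ ε ∈ Icc 0 ε₁, IsMinimalQuasiPeriodicTorus σ (quasilinear A f (ε • F)) univ (u ε)) ∧
      Tendsto (fun ε => ⨆ ω, ‖u ε ω - u 0 ω‖) (𝓝[>] 0) (𝓝 0) := by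
  have hN := hU.N_pos
  have hν := hU.ν_pos
  set γ := linearTorus σ U P f with hγ
  set g₀ : ℝ := ⨆ ω, ‖F (ω, γ ω)‖ with hg₀
  have hg₀0 : 0 ≤ g₀ := Real.iSup_nonneg fun _ => norm_nonneg _
  set κ := ν / (2 * N) with hκ
  have hκ0 : 0 < κ := by positivity
  have hsup : ∀ ε : ℝ, 0 ≤ ε → (⨆ ω, ‖(ε • F) (ω, γ ω)‖) = ε * g₀ := fun ε hε => by
    simp only [ContinuousMap.smul_apply, norm_smul, Real.norm_of_nonneg hε]
    exact (Real.mul_iSup_of_nonneg hε _).symm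
  have hlim : Tendsto (fun ε : ℝ => ε * g₀ / (κ - ε * L)) (𝓝 0) (𝓝 0) := by
    have h : ContinuousAt (fun ε : ℝ => ε * g₀ / (κ - ε * L)) 0 :=
      ContinuousAt.div (by fun_prop) (by fun_prop) (by simpa using hκ0.ne')
    simpa using h.tendsto
  have hlim2 : Tendsto (fun ε : ℝ => ε * L) (𝓝 0) (𝓝 0) := by
    simpa using (continuous_id.mul continuous_const).tendsto (0 : ℝ) (f := fun ε : ℝ => ε * L)
  -- The three conditions keep the ball inside the tube, make the map a contraction, and keep `ε` in
  -- the range where solutions are unique.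
  have hev : ∀ᶠ ε in 𝓝 (0 : ℝ), ε * g₀ / (κ - ε * L) < r ∧ ε * L < κ ∧ ε < ε₀ :=
    (hlim.eventually (gt_mem_nhds hr)).and
      ((hlim2.eventually (gt_mem_nhds hκ0)).and (gt_mem_nhds hε₀))
  obtain ⟨δ, hδ, hδ'⟩ := Metric.eventually_nhds_iff.1 hev
  have hex : ∀ ε ∈ Icc 0 (min ε₀ (δ / 2)), ∃ u : C(Ω, E),
      IsMinimalQuasiPeriodicTorus σ (quasilinear A f (ε • F)) univ u ∧
        ∀ ω, ‖u ω - γ ω‖ ≤ ε * g₀ / (κ - ε * L) := fun ε hε => by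
    have hεδ : ε ≤ δ / 2 := hε.2.trans (min_le_right _ _)
    obtain ⟨h1, h2, h3⟩ := hδ' (y := ε) (by
      rw [Real.dist_eq, sub_zero, abs_of_nonneg hε.1]; linarith)
    have hlip : LipschitzInSpace (ε • F) (tube γ r) (ε * L) := fun ω x₁ hx₁ x₂ hx₂ => by
      rw [ContinuousMap.smul_apply, ContinuousMap.smul_apply, ← smul_sub, norm_smul,
        Real.norm_of_nonneg hε.1, mul_assoc]
      exact mul_le_mul_of_nonneg_left (hF ω x₁ hx₁ x₂ hx₂) hε.1
    have := hU.exists_torus_quasilinear hmin hqp (F := ε • F) (mul_nonneg hε.1 hL.le) h2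
      (r := r) (by rw [← hγ, hsup ε hε.1]; exact h1.le) hlip (huniq ε ⟨hε.1, h3.le⟩)
    rwa [← hγ, hsup ε hε.1] at this
  have hε₁ : 0 < min ε₀ (δ / 2) := lt_min hε₀ (by positivity)
  choose! u hu hb using hex
  refine ⟨min ε₀ (δ / 2), ⟨hε₁, min_le_left _ _⟩, u, hu, ?_⟩
  -- At `ε = 0` the distance bound is zero, so the unperturbed torus is `γ` itself.
  have h0 : ∀ ω, u 0 ω = γ ω := fun ω => by
    simpa [sub_eq_zero] using hb 0 ⟨le_rfl, hε₁.le⟩ ω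
  refine squeeze_zero' (Eventually.of_forall fun ε => Real.iSup_nonneg fun _ => norm_nonneg _) ?_
    (hlim.mono_left nhdsWithin_le_nhds)
  filter_upwards [Ioo_mem_nhdsGT hε₁] with ε hε
  have hmem : ε ∈ Icc 0 (min ε₀ (δ / 2)) := ⟨hε.1.le, hε.2.le⟩
  simp only [h0]
  obtain ⟨ω, -⟩ := hmin.nonempty
  have : Nonempty Ω := ⟨ω⟩
  exact ciSup_le (hb ε hmem)

end Quasilinear

end InvTorus

namespace InvTorus

/-! ### Spectral separation from an exponential by characters -/

section SpectralMapping

theorem le_one_of_forall_pow_le {x C : ℝ} (h : ∀ n : ℕ, x ^ n ≤ C) : x ≤ 1 := by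
  by_contra hx
  obtain ⟨n, hn⟩ := ((tendsto_pow_atTop_atTop_of_one_lt (not_le.1 hx)).eventually
    (eventually_gt_atTop C)).exists
  exact (h n).not_gt hn

/-- In a commutative complex Banach algebra, the exponential of an element whose spectrum misses
the imaginary axis differs from every element with bounded powers by a unit. -/
theorem isUnit_sub_exp_of_commutative {𝒞 : Type*} [NormedCommRing 𝒞] [NormedAlgebra ℂ 𝒞]
    [CompleteSpace 𝒞] {a v w : 𝒞} {C : ℝ} (hvw : v * w = 1) (hv : ∀ n : ℕ, ‖v ^ n‖ ≤ C)
    (hw : ∀ n : ℕ, ‖w ^ n‖ ≤ C) (ha : ∀ s : ℝ, IsUnit (a * a + algebraMap ℂ 𝒞 ((s : ℂ) ^ 2))) :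
    IsUnit (v - NormedSpace.exp a) := by
  by_contra hunit
  -- A non-unit is annihilated by some character `χ`, so `χ v = exp (χ a)`. Bounded powers of `v`
  -- and of its inverse `w` force `‖χ v‖ = 1`, hence `χ a` is purely imaginary.
  obtain ⟨χ, hχ⟩ := WeakDual.CharacterSpace.exists_apply_eq_zero hunit
  let _ : NormedAlgebra ℚ 𝒞 := .restrictScalars ℚ ℂ 𝒞
  have hexp : χ v = NormedSpace.exp (χ a) := by
    rw [map_sub, sub_eq_zero] at hχ
    rw [hχ, NormedSpace.map_exp χ (map_continuous χ) a]
  rw [← Complex.exp_eq_exp_ℂ] at hexp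
  obtain ⟨M, hM⟩ : ∃ M : ℝ, ∀ x, ‖χ x‖ ≤ M * ‖x‖ :=
    ⟨‖WeakDual.CharacterSpace.toCLM χ‖, (WeakDual.CharacterSpace.toCLM χ).le_opNorm⟩
  have hbound : ∀ y : 𝒞, (∀ n : ℕ, ‖y ^ n‖ ≤ C) → ‖χ y‖ ≤ 1 := fun y hy => by
    refine le_one_of_forall_pow_le (C := |M| * C) fun n => ?_
    rw [← norm_pow, ← map_pow]
    refine (hM _).trans ?_
    exact mul_le_mul (le_abs_self M) (hy n) (norm_nonneg _) (abs_nonneg M)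
  have h1 := hbound v hv
  have h2 := hbound w hw
  have h3 : ‖χ v‖ * ‖χ w‖ = 1 := by rw [← norm_mul, ← map_mul, hvw, map_one, norm_one]
  have h4 : ‖χ v‖ = 1 := by nlinarith [norm_nonneg (χ v), norm_nonneg (χ w)]
  rw [hexp, Complex.norm_exp, Real.exp_eq_one_iff] at h4
  -- With `s` the imaginary part of `χ a`, the unit `a * a + s ^ 2` is sent to `0`.
  have h5 := (ha (χ a).im).map χ
  refine h5.ne_zero ?_
  rw [map_add, map_mul, AlgHomClass.commutes, Algebra.algebraMap_self_apply]
  apply Complex.ext <;> simp [h4, pow_two]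

/-- The double centralizer of `{a, v}` is a closed commutative subalgebra containing `a` and `v`. It
also contains the inverses of its elements that are units in the large algebra, so invertibility is
the same in both and the commutative case applies. -/
theorem isUnit_sub_exp {𝔹 : Type*} [NormedRing 𝔹] [NormedAlgebra ℂ 𝔹]
    [CompleteSpace 𝔹] {a v w : 𝔹} {C : ℝ} (hav : Commute a v) (hvw : v * w = 1) (hwv : w * v = 1)
    (hv : ∀ n : ℕ, ‖v ^ n‖ ≤ C) (hw : ∀ n : ℕ, ‖w ^ n‖ ≤ C)
    (ha : ∀ s : ℝ, IsUnit (a * a + algebraMap ℂ 𝔹 ((s : ℂ) ^ 2))) :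
    IsUnit (v - NormedSpace.exp a) := by
  let 𝒮 : Subalgebra ℂ 𝔹 := Subalgebra.centralizer ℂ {a, v}
  let 𝒞 : Subalgebra ℂ 𝔹 := Subalgebra.centralizer ℂ (𝒮 : Set 𝔹)
  have hmem : ∀ {x}, x ∈ 𝒞 ↔ ∀ y, Commute a y → Commute v y → Commute y x := by
    intro x
    simp only [𝒞, 𝒮, Subalgebra.mem_centralizer_iff, SetLike.mem_coe, Commute, SemiconjBy,
      mem_insert_iff, mem_singleton_iff, forall_eq_or_imp, forall_eq, and_imp]
  have haC : a ∈ 𝒞 := hmem.2 fun y h _ => h.symm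
  have hvC : v ∈ 𝒞 := hmem.2 fun y _ h => h.symm
  have hinv : ∀ {x y : 𝔹}, x ∈ 𝒞 → x * y = 1 → y * x = 1 → y ∈ 𝒞 := fun {x y} hx hxy hyx =>
    hmem.2 fun z h1 h2 => Commute.units_inv_right (u := ⟨x, y, hxy, hyx⟩) (hmem.1 hx z h1 h2)
  have hwC : w ∈ 𝒞 := hinv hvC hvw hwv
  have hcomm : ∀ x y : 𝒞, x * y = y * x := fun x y => by
    have hx : Commute a x := hmem.1 x.2 a (Commute.refl a) hav.symm
    have hx' : Commute v x := hmem.1 x.2 v hav (Commute.refl v)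
    exact Subtype.ext (hmem.1 y.2 x hx hx')
  have hunit : ∀ x : 𝒞, IsUnit (x : 𝔹) → IsUnit x := by
    rintro x ⟨u, hu⟩
    have hu' : (↑u⁻¹ : 𝔹) ∈ 𝒞 := hinv x.2 (by rw [← hu, Units.mul_inv]) (by rw [← hu, Units.inv_mul])
    exact ⟨⟨x, ⟨_, hu'⟩, Subtype.ext (by simp [← hu]), Subtype.ext (by simp [← hu])⟩, rfl⟩
  let _ : NormedCommRing 𝒞 := { (inferInstance : NormedRing 𝒞) with mul_comm := hcomm }
  have hclosed : IsClosed (𝒞 : Set 𝔹) := by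
    simpa [𝒞] using Set.isClosed_centralizer (𝒮 : Set 𝔹)
  have : CompleteSpace 𝒞 := hclosed.completeSpace_coe
  have h := isUnit_sub_exp_of_commutative (a := (⟨a, haC⟩ : 𝒞)) (v := ⟨v, hvC⟩) (w := ⟨w, hwC⟩)
    (C := C) (Subtype.ext hvw) (fun n => hv n) (fun n => hw n) (fun s => hunit _ (ha s))
  let _ : NormedAlgebra ℚ 𝒞 := .restrictScalars ℚ ℂ 𝒞
  let _ : NormedAlgebra ℚ 𝔹 := .restrictScalars ℚ ℂ 𝔹
  have h' := h.map 𝒞.val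
  rw [map_sub, NormedSpace.map_exp 𝒞.val continuous_subtype_val] at h'
  exact h'

end SpectralMapping

/-! ### Passage from real to complex Banach spaces -/

section Complexification

/-- The complexification of a real normed space `Y`, realized as the space of real linear maps
`ℂ → Y`, on which `ℂ` acts by isometries up to scaling. -/
def Complexification (Y : Type*) [NormedAddCommGroup Y] [NormedSpace ℝ Y] : Type _ := ℂ →L[ℝ] Y

variable {Y : Type*} [NormedAddCommGroup Y] [NormedSpace ℝ Y]

noncomputable instance : NormedAddCommGroup (Complexification Y) :=
  inferInstanceAs (NormedAddCommGroup (ℂ →L[ℝ] Y))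

instance [CompleteSpace Y] : CompleteSpace (Complexification Y) :=
  inferInstanceAs (CompleteSpace (ℂ →L[ℝ] Y))

noncomputable instance : FunLike (Complexification Y) ℂ Y := inferInstanceAs (FunLike (ℂ →L[ℝ] Y) ℂ Y)

noncomputable instance : SMul ℂ (Complexification Y) :=
  ⟨fun w f => (show ℂ →L[ℝ] Y from f).comp (ContinuousLinearMap.mul ℝ ℂ w)⟩

namespace Complexification

@[ext]
theorem ext {f g : Complexification Y} (h : ∀ z, f z = g z) : f = g := DFunLike.ext f g h

@[simp]
theorem smul_apply (w z : ℂ) (f : Complexification Y) : (w • f) z = f (w * z) := rfl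

@[simp]
theorem add_apply (z : ℂ) (f g : Complexification Y) : (f + g) z = f z + g z := rfl

@[simp]
theorem zero_apply (z : ℂ) : (0 : Complexification Y) z = 0 := rfl

theorem map_add' (f : Complexification Y) (z w : ℂ) : f (z + w) = f z + f w :=
  map_add (show ℂ →L[ℝ] Y from f) z w

theorem map_zero' (f : Complexification Y) : f 0 = 0 := map_zero (show ℂ →L[ℝ] Y from f)

theorem apply_real_mul (f : Complexification Y) (c : ℝ) (z : ℂ) : f (c * z) = c • f z := by
  have h := map_smul (show ℂ →L[ℝ] Y from f) c z
  rwa [Complex.real_smul] at h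

/-- The operator norm is compatible with complex scalars because precomposition with multiplication
by `w` costs at most a factor `‖w‖`; a supremum norm on `Y × Y` would lack this. -/
noncomputable instance : NormedSpace ℂ (Complexification Y) where
  one_smul f := by ext z; simp
  mul_smul w w' f := by ext z; simp [mul_assoc, mul_left_comm]
  smul_zero w := by ext z; simp
  smul_add w f g := by ext z; simp
  add_smul w w' f := by ext z; simp [add_mul, map_add']
  zero_smul f := by ext z; simp [map_zero']
  norm_smul_le w f := by
    rw [mul_comm]
    refine (ContinuousLinearMap.opNorm_comp_le (show ℂ →L[ℝ] Y from f)
      (ContinuousLinearMap.mul ℝ ℂ w)).trans ?_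
    exact mul_le_mul_of_nonneg_left (ContinuousLinearMap.opNorm_mul_apply_le ℝ ℂ w) (norm_nonneg _)

/-- The complex linear extension of a real bounded operator. -/
noncomputable def extend (b : Y →L[ℝ] Y) : Complexification Y →L[ℂ] Complexification Y :=
  LinearMap.mkContinuous
    { toFun := fun f => b.comp (show ℂ →L[ℝ] Y from f)
      map_add' := fun _ _ => ContinuousLinearMap.comp_add b _ _
      map_smul' := fun _ _ => rfl } ‖b‖ fun f =>
    ContinuousLinearMap.opNorm_comp_le b (show ℂ →L[ℝ] Y from f)

@[simp]
theorem extend_apply (b : Y →L[ℝ] Y) (f : Complexification Y) (z : ℂ) :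
    extend b f z = b (f z) := rfl

theorem norm_extend_le (b : Y →L[ℝ] Y) : ‖extend b‖ ≤ ‖b‖ :=
  LinearMap.mkContinuous_norm_le _ (norm_nonneg _) _

/-- Complex linear extension as a ring homomorphism. -/
noncomputable def extendHom : (Y →L[ℝ] Y) →+* (Complexification Y →L[ℂ] Complexification Y) where
  toFun := extend
  map_one' := rfl
  map_mul' _ _ := rfl
  map_zero' := rfl
  map_add' _ _ := rfl

theorem continuous_extendHom : Continuous (extendHom (Y := Y)) :=
  AddMonoidHomClass.continuous_of_bound extendHom 1 fun b => by
    rw [one_mul]; exact norm_extend_le b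

/-- The real part of the complexification. -/
noncomputable def ofReal (y : Y) : Complexification Y :=
  (show ℂ →L[ℝ] Y from Complex.reCLM.smulRight y)

@[simp]
theorem ofReal_apply (y : Y) (z : ℂ) : ofReal y z = z.re • y := rfl

/-- Bijectivity descends by testing on the vectors `ofReal y` and evaluating at `1`; the open
mapping theorem makes the inverse bounded. -/
theorem isUnit_of_isUnit_extendHom [CompleteSpace Y] {b : Y →L[ℝ] Y} (h : IsUnit (extendHom b)) :
    IsUnit b := by
  obtain ⟨u, hu⟩ := h
  have h1 : ∀ f, extend b ((↑u⁻¹ : Complexification Y →L[ℂ] Complexification Y) f) = f := fun f =>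
    DFunLike.congr_fun (show extend b * ↑u⁻¹ = 1 by rw [← Units.mul_inv u, hu]; rfl) f
  have h2 : ∀ f, (↑u⁻¹ : Complexification Y →L[ℂ] Complexification Y) (extend b f) = f := fun f =>
    DFunLike.congr_fun (show ↑u⁻¹ * extend b = 1 by rw [← Units.inv_mul u, hu]; rfl) f
  rw [ContinuousLinearMap.isUnit_iff_bijective]
  refine ⟨(injective_iff_map_eq_zero b).2 fun y hy => ?_, fun y => ?_⟩
  · have h3 : extend b (ofReal y) = 0 := by ext z; simp [hy]
    have h4 := h2 (ofReal y)
    rw [h3, map_zero] at h4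
    simpa using (DFunLike.congr_fun h4 (1 : ℂ)).symm
  · refine ⟨(↑u⁻¹ : Complexification Y →L[ℂ] Complexification Y) (ofReal y) 1, ?_⟩
    rw [← extend_apply, h1]
    simp

end Complexification

/-- On a real Banach space, the exponential of an operator whose spectrum misses the imaginary axis
differs by an isomorphism from every commuting operator that generates a bounded group. -/
theorem isUnit_sub_exp_real {Y : Type*} [NormedAddCommGroup Y] [NormedSpace ℝ Y] [CompleteSpace Y]
    {a v w : Y →L[ℝ] Y} {C : ℝ} (hav : Commute a v) (hvw : v * w = 1)
    (hwv : w * v = 1) (hv : ∀ n : ℕ, ‖v ^ n‖ ≤ C) (hw : ∀ n : ℕ, ‖w ^ n‖ ≤ C)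
    (ha : ∀ s : ℝ, IsUnit (a * a + algebraMap ℝ (Y →L[ℝ] Y) (s ^ 2))) :
    IsUnit (v - NormedSpace.exp a) := by
  open Complexification in
  let _ : NormedAlgebra ℚ (Y →L[ℝ] Y) := .restrictScalars ℚ ℝ _
  let _ : NormedAlgebra ℚ (Complexification Y →L[ℂ] Complexification Y) := .restrictScalars ℚ ℂ _
  refine isUnit_of_isUnit_extendHom ?_
  rw [map_sub, NormedSpace.map_exp extendHom continuous_extendHom]
  refine isUnit_sub_exp (w := extendHom w) (C := C) (hav.map extendHom)
    (by rw [← map_mul, hvw, map_one]) (by rw [← map_mul, hwv, map_one]) (fun n => ?_) (fun n => ?_)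
    fun s => ?_
  · rw [← map_pow]; exact (norm_extend_le _).trans (hv n)
  · rw [← map_pow]; exact (norm_extend_le _).trans (hw n)
  · have h := (ha s).map (extendHom (Y := Y))
    rw [map_add, map_mul] at h
    convert h using 2
    ext f z
    simp only [Algebra.algebraMap_eq_smul_one, extendHom]
    change f ((s : ℂ) ^ 2 * z) = (s ^ 2) • f z
    rw [← apply_real_mul]
    push_cast
    rfl

end Complexification

end InvTorus

namespace InvTorus

/-! ### Exponential dichotomy from the difference equation on bounded sequences -/

section Dichotomy

open BoundedContinuousFunction

variable {E : Type*} [NormedAddCommGroup E] [NormedSpace ℝ E]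

theorem exp_add_smul [CompleteSpace E] (a : E →L[ℝ] E) (s t : ℝ) :
    NormedSpace.exp ((s + t) • a) = NormedSpace.exp (s • a) * NormedSpace.exp (t • a) := by
  let _ : NormedAlgebra ℚ (E →L[ℝ] E) := .restrictScalars ℚ ℝ _
  rw [add_smul, NormedSpace.exp_add_of_commute]
  exact ((Commute.refl a).smul_left s).smul_right t

theorem continuous_exp_smul [CompleteSpace E] (a : E →L[ℝ] E) :
    Continuous fun t : ℝ => NormedSpace.exp (t • a) :=
  continuous_iff_continuousAt.2 fun t => (hasDerivAt_exp_smul_const a t).continuousAt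

/-- The action of operators on bounded sequences, term by term. -/
noncomputable def termwise : (E →L[ℝ] E) →+* ((ℤ →ᵇ E) →L[ℝ] (ℤ →ᵇ E)) where
  toFun b := b.compLeftContinuousBounded ℤ
  map_one' := rfl
  map_mul' _ _ := rfl
  map_zero' := rfl
  map_add' _ _ := rfl

theorem termwise_apply (b : E →L[ℝ] E) (x : ℤ →ᵇ E) (n : ℤ) : termwise b x n = b (x n) := rfl

theorem continuous_termwise : Continuous (termwise (E := E)) :=
  AddMonoidHomClass.continuous_of_bound termwise 1 fun b => by
    rw [one_mul]
    refine ContinuousLinearMap.opNorm_le_bound _ (norm_nonneg _) fun x => ?_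
    exact (BoundedContinuousFunction.norm_le (by positivity)).2 fun n =>
      b.le_opNorm_of_le (x.norm_coe_le_norm n)

/-- The shift by `k` of bounded sequences. -/
noncomputable def shift (k : ℤ) : (ℤ →ᵇ E) →L[ℝ] (ℤ →ᵇ E) :=
  LinearMap.mkContinuous
    { toFun := fun x => x.compContinuous ⟨fun n => n + k, continuous_of_discreteTopology⟩
      map_add' := fun _ _ => rfl
      map_smul' := fun _ _ => rfl } 1 fun x => by
    rw [one_mul]
    exact (BoundedContinuousFunction.norm_le (norm_nonneg _)).2 fun n => x.norm_coe_le_norm _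

theorem shift_apply (k : ℤ) (x : ℤ →ᵇ E) (n : ℤ) : shift k x n = x (n + k) := rfl

theorem norm_shift_pow_le (k : ℤ) (n : ℕ) : ‖(shift k : (ℤ →ᵇ E) →L[ℝ] (ℤ →ᵇ E)) ^ n‖ ≤ 1 := by
  induction n with
  | zero => exact ContinuousLinearMap.norm_id_le
  | succ n ih =>
    rw [pow_succ]
    refine (norm_mul_le _ _).trans (mul_le_one₀ ih (norm_nonneg _) ?_)
    exact LinearMap.mkContinuous_norm_le _ zero_le_one _

/-- The sequence with single nonzero term `y` at `0`. -/
noncomputable def impulse : E →L[ℝ] (ℤ →ᵇ E) :=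
  LinearMap.mkContinuous
    { toFun := fun y => ofNormedAddCommGroup (fun n : ℤ => if n = 0 then y else 0)
        continuous_of_discreteTopology ‖y‖ fun n => by split_ifs <;> simp
      map_add' := fun y z => by ext n; by_cases h : n = 0 <;> simp [h]
      map_smul' := fun c y => by ext n; by_cases h : n = 0 <;> simp [h] } 1 fun y => by
    rw [one_mul]
    refine (BoundedContinuousFunction.norm_le (norm_nonneg _)).2 fun n => ?_
    change ‖if n = 0 then y else 0‖ ≤ ‖y‖
    split_ifs <;> simp

theorem norm_impulse_le (y : E) : ‖impulse y‖ ≤ ‖y‖ :=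
  (BoundedContinuousFunction.norm_le (norm_nonneg _)).2 fun n => by
    change ‖if n = 0 then y else 0‖ ≤ ‖y‖
    split_ifs <;> simp

/-- The inhomogeneous difference equation for the exponential of an operator whose spectrum misses
the imaginary axis is uniquely solvable in bounded sequences. -/
theorem exists_bounded_solution_operator [CompleteSpace E] {a : E →L[ℝ] E}
    (ha : ∀ s : ℝ, IsUnit (a * a + algebraMap ℝ (E →L[ℝ] E) (s ^ 2))) :
    ∃ R : (ℤ →ᵇ E) →L[ℝ] (ℤ →ᵇ E), ∀ x h : ℤ →ᵇ E,
      (∀ n, x (n + 1) = NormedSpace.exp a (x n) + h n) ↔ x = R h := by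
  let _ : NormedAlgebra ℚ (E →L[ℝ] E) := .restrictScalars ℚ ℝ _
  let _ : NormedAlgebra ℚ ((ℤ →ᵇ E) →L[ℝ] (ℤ →ᵇ E)) := .restrictScalars ℚ ℝ _
  -- The difference equation reads `(shift 1 - exp a) x = h`. All powers of the shift and of its
  -- inverse have norm at most `1`, which is the boundedness needed to separate them from `exp a`.
  have hunit : IsUnit (shift 1 - NormedSpace.exp (termwise a)) := by
    refine isUnit_sub_exp_real (w := shift (-1)) (C := 1) ?_ ?_ ?_ (norm_shift_pow_le 1)
      (norm_shift_pow_le (-1)) fun s => ?_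
    · rfl
    · ext x n
      simp [shift_apply]
    · ext x n
      simp [shift_apply]
    · have h := (ha s).map (termwise (E := E))
      rw [map_add, map_mul] at h
      convert h using 2
      ext x n
      simp [termwise_apply, Algebra.algebraMap_eq_smul_one]
  rw [← NormedSpace.map_exp termwise continuous_termwise] at hunit
  obtain ⟨u, hu⟩ := hunit
  refine ⟨↑u⁻¹, fun x h => ?_⟩
  have h1 : x = (↑u⁻¹ : (ℤ →ᵇ E) →L[ℝ] (ℤ →ᵇ E)) h ↔
      (u : (ℤ →ᵇ E) →L[ℝ] (ℤ →ᵇ E)) x = h := by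
    constructor
    · rintro rfl
      rw [← mul_apply_eq_comp, Units.mul_inv]
      rfl
    · rintro rfl
      rw [← mul_apply_eq_comp, Units.inv_mul]
      rfl
  rw [h1, hu, BoundedContinuousFunction.ext_iff]
  refine forall_congr' fun n => ?_
  rw [_root_.sub_apply, BoundedContinuousFunction.sub_apply, shift_apply, termwise_apply, sub_eq_iff_eq_add']

/-- A multiplicative one-parameter family that is contracted at some positive time decays
exponentially. -/
theorem exists_exp_decay {𝔸 : Type*} [NormedRing 𝔸] {S : ℝ → 𝔸} (hc : Continuous S)
    (hadd : ∀ s t, S (s + t) = S s * S t) {T : ℝ} (hT : 0 < T) (hST : ‖S T‖ ≤ 1 / 2) :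
    ∃ N > 0, ∃ ν > 0, ∀ t, 0 ≤ t → ‖S t‖ ≤ N * Real.exp (-ν * t) := by
  obtain ⟨M, hM⟩ := (isCompact_Icc (a := 0) (b := T)).exists_bound_of_continuousOn hc.continuousOn
  have hM0 : 0 ≤ M := (norm_nonneg _).trans (hM 0 ⟨le_rfl, hT.le⟩)
  have hlog : 0 < Real.log 2 := Real.log_pos one_lt_two
  have hpow : ∀ (k : ℕ) (s : ℝ), s ∈ Icc 0 T → ‖S (k * T + s)‖ ≤ (1 / 2) ^ k * M := by
    intro k s hs
    induction k with
    | zero => simpa using hM s hs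
    | succ k ih =>
      have : ((k + 1 : ℕ) : ℝ) * T + s = T + (k * T + s) := by push_cast; ring
      rw [this, hadd, pow_succ', mul_assoc]
      exact (norm_mul_le _ _).trans (mul_le_mul hST ih (norm_nonneg _) (by norm_num))
  -- The norm halves in each period `T`, hence the rate `log 2 / T`. The factor `2` pays for
  -- rounding `t / T` down, and `M + 1` keeps the constant positive.
  refine ⟨2 * (M + 1), by positivity, Real.log 2 / T, by positivity, fun t ht => ?_⟩
  set k := ⌊t / T⌋₊ with hk
  have hk1 : (k : ℝ) * T ≤ t := by
    rw [← le_div_iff₀ hT]; exact Nat.floor_le (by positivity)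
  have hk2 : t < (k + 1) * T := by
    rw [← div_lt_iff₀ hT]; exact Nat.lt_floor_add_one _
  have h := hpow k (t - k * T) ⟨by linarith, by linarith⟩
  rw [add_sub_cancel] at h
  have hexp : ((1 : ℝ) / 2) ^ k ≤ 2 * Real.exp (-(Real.log 2 / T) * t) := by
    have h2 : (2 : ℝ) * Real.exp (-(Real.log 2 / T) * t) =
        Real.exp (Real.log 2 - Real.log 2 / T * t) := by
      rw [sub_eq_add_neg, Real.exp_add, Real.exp_log two_pos, neg_mul]
    have h3 : ((1 : ℝ) / 2) ^ k = Real.exp (-(k * Real.log 2)) := by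
      rw [Real.exp_neg, Real.exp_nat_mul, Real.exp_log two_pos, one_div, inv_pow]
    rw [h2, h3, Real.exp_le_exp]
    have h4 : t / T < k + 1 := by rwa [div_lt_iff₀ hT]
    have h5 : Real.log 2 / T * t = Real.log 2 * (t / T) := by ring
    rw [h5]
    nlinarith
  calc ‖S t‖ ≤ (1 / 2) ^ k * M := h
    _ ≤ (2 * Real.exp (-(Real.log 2 / T) * t)) * (M + 1) :=
        mul_le_mul hexp (by linarith) hM0 (by positivity)
    _ = _ := by ring

/-- An operator whose spectrum misses the imaginary axis generates an exponential dichotomy. -/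
theorem exists_dichotomy [CompleteSpace E] {a : E →L[ℝ] E}
    (ha : ∀ s : ℝ, IsUnit (a * a + algebraMap ℝ (E →L[ℝ] E) (s ^ 2))) :
    ∃ P : E →L[ℝ] E, P * P = P ∧ Commute P a ∧ ∃ N > 0, ∃ ν > 0,
      (∀ t : ℝ, 0 ≤ t → ‖NormedSpace.exp (t • a) * P‖ ≤ N * Real.exp (-ν * t)) ∧
      ∀ t : ℝ, 0 ≤ t → ‖NormedSpace.exp ((-t) • a) * (1 - P)‖ ≤ N * Real.exp (-ν * t) := by
  obtain ⟨R, hR⟩ := exists_bounded_solution_operator ha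
  have hzero : ∀ x : ℤ →ᵇ E, (∀ n, x (n + 1) = NormedSpace.exp a (x n)) → x = 0 := fun x hx => by
    simpa using (hR x 0).1 (by simpa using hx)
  let e : ℝ → E →L[ℝ] E := fun t => NormedSpace.exp (t • a)
  have he : ∀ s t, e (s + t) = e s * e t := exp_add_smul a
  have he0 : e 0 = 1 := by simp [e, NormedSpace.exp_zero]
  have he1 : e 1 = NormedSpace.exp a := by simp [e]
  -- the discrete Green function
  let g : ℤ → E →L[ℝ] E := fun n => (evalCLM ℝ n).comp (R.comp impulse)
  have hg : ∀ n y, g n y = R (impulse y) n := fun _ _ => rfl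
  have hgrec : ∀ n y, g (n + 1) y = e 1 (g n y) + if n = 0 then y else 0 := fun n y => by
    rw [he1]
    exact (hR (R (impulse y)) (impulse y)).2 rfl n
  have hg1 : g 1 = e 1 * g 0 + 1 := by
    ext y
    simpa using hgrec 0 y
  have hgs : ∀ n, n ≠ 0 → g (n + 1) = e 1 * g n := fun n hn => by
    ext y
    simpa [hn] using hgrec n y
  obtain ⟨C, hC0, hC⟩ : ∃ C : ℝ, 0 < C ∧ ‖R‖ ≤ C := ⟨‖R‖ + 1, by positivity, by linarith⟩
  have hgC : ∀ n y, ‖g n y‖ ≤ C * ‖y‖ := fun n y => by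
    rw [hg]
    refine ((R (impulse y)).norm_coe_le_norm n).trans (R.le_of_opNorm_le_of_le hC (norm_impulse_le y))
  -- Across `0` the response jumps by the identity: `P` is its value just after the impulse, and `1
  -- - P = -(e 1 * g 0)`. So `P` has a bounded forward orbit and `1 - P` a bounded backward orbit,
  -- as for the projection onto the stable space.
  set P := g 1 with hP
  have hstab : ∀ n : ℕ, e n * P = g (n + 1) := fun n => by
    induction n with
    | zero => simp [he0, hP]
    | succ n ih =>
      rw [hgs _ (by positivity)]
      push_cast
      rw [← ih, add_comm, he, mul_assoc]
  have hunst : ∀ n : ℕ, e (-(n + 1)) * (1 - P) = -g (-n) := fun n => by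
    induction n with
    | zero =>
      rw [hg1, sub_add_cancel_right, Nat.cast_zero, zero_add, mul_neg, ← mul_assoc, ← he]
      simp [he0]
    | succ n ih =>
      have h1 := hgs (-((n + 1 : ℕ) : ℤ)) (by push_cast; omega)
      have h2 : (-((n + 1 : ℕ) : ℤ)) + 1 = -n := by push_cast; ring
      have h3 : (-(((n + 1 : ℕ) : ℝ) + 1)) = -1 + -(n + 1) := by push_cast; ring
      rw [h2] at h1
      rw [h3, he, mul_assoc, ih, h1, mul_neg, ← mul_assoc, ← he]
      simp [he0]
  have hcomm_e : ∀ t, Commute a (e t) := fun t => by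
    let _ : NormedAlgebra ℚ (E →L[ℝ] E) := .restrictScalars ℚ ℝ _
    exact ((Commute.refl a).smul_right t).exp_right
  have hcomm : ∀ n, Commute (g n) a := fun n => by
    ext y
    -- The responses to `a y` and `a` applied to the response to `y` have the same forcing, so their
    -- difference is a bounded homogeneous solution.
    have h0 := hzero (a.compLeftContinuousBounded ℤ (R (impulse y)) - R (impulse (a y))) fun n => by
      have h1 : a (e 1 (g n y)) = e 1 (a (g n y)) := DFunLike.congr_fun (hcomm_e 1) _
      have h2 := hgrec n y
      have h3 := hgrec n (a y)
      rw [he1] at h1 h2 h3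
      simp only [BoundedContinuousFunction.sub_apply,
        ContinuousLinearMap.compLeftContinuousBounded_apply, ← hg, h2, h3, map_add, map_sub, h1]
      split_ifs <;> simp
    have h4 := DFunLike.congr_fun h0 n
    exact (sub_eq_zero.1 h4).symm
  have hPa : Commute P a := hcomm 1
  have hPe : ∀ t, Commute P (e t) := fun t => by
    let _ : NormedAlgebra ℚ (E →L[ℝ] E) := .restrictScalars ℚ ℝ _
    exact (hPa.smul_right t).exp_right
  have hPP : P * P = P := by
    -- The orbit of `P ((1 - P) y)` is bounded forward because of `P` and backward because of `1 -
    -- P`, the two factors commuting; a bounded homogeneous orbit vanishes.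
    have hprod : P * (1 - P) = 0 := by
      ext y
      have hbd : ∀ n : ℤ, ‖e n (P ((1 - P) y))‖ ≤ C * ‖(1 - P) y‖ + C * ‖P y‖ := fun n => by
        rcases le_or_gt 0 n with hn | hn
        · obtain ⟨k, rfl⟩ := Int.eq_ofNat_of_zero_le hn
          have h1 : e ((k : ℤ) : ℝ) (P ((1 - P) y)) = g (k + 1) ((1 - P) y) := by
            rw [← hstab k]; rfl
          rw [h1]
          have := hgC (k + 1) ((1 - P) y)
          have := mul_nonneg hC0.le (norm_nonneg (P y))
          linarith
        · obtain ⟨k, rfl⟩ : ∃ k : ℕ, n = -(k + 1) := ⟨(-n - 1).toNat, by omega⟩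
          have h1 : e ((-(k + 1) : ℤ) : ℝ) (P ((1 - P) y)) = -g (-k) (P y) := by
            have h2 := DFunLike.congr_fun (hunst k) (P y)
            have h3 : P ((1 - P) y) = (1 - P) (P y) := by simp
            rw [h3]
            push_cast
            exact h2
          rw [h1, norm_neg]
          have := hgC (-k) (P y)
          have := mul_nonneg hC0.le (norm_nonneg ((1 - P) y))
          linarith
      have h0 := hzero (ofNormedAddCommGroup (fun n : ℤ => e n (P ((1 - P) y)))
        continuous_of_discreteTopology _ hbd) fun n => by
          simp only [coe_ofNormedAddCommGroup]
          rw [← he1]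
          push_cast
          rw [add_comm, he]
          rfl
      have h1 := DFunLike.congr_fun h0 0
      simpa [he0] using h1
    rw [mul_sub, mul_one, sub_eq_zero] at hprod
    exact hprod.symm
  -- Weight the response by `min |k| |n|`. The weight vanishes at `0`, removing the impulse; the cap
  -- keeps the sequence bounded; the slope is at most `1`, so the new forcing is bounded by `C *
  -- ‖y‖` and one more use of `R` gives the bound.
  have hdecay : ∀ n : ℤ, |(n : ℝ)| * ‖g n‖ ≤ C * C := fun n => by
    have h : ∀ y, ‖|(n : ℝ)| • g n y‖ ≤ C * C * ‖y‖ := fun y => by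
      let c : ℤ → ℝ := fun k => min |(k : ℝ)| |(n : ℝ)|
      have hc : ∀ k, |c (k + 1) - c k| ≤ 1 := fun k => by
        refine (abs_min_sub_min_le_max _ _ _ _).trans ?_
        rw [sub_self, abs_zero, max_eq_left (abs_nonneg _)]
        refine (abs_abs_sub_abs_le _ _).trans ?_
        simp
      have hc0 : c 0 = 0 := by simp [c]
      let x : ℤ →ᵇ E := ofNormedAddCommGroup (fun k => c k • g k y) continuous_of_discreteTopology
        (|(n : ℝ)| * (C * ‖y‖)) fun k => by
          rw [norm_smul, Real.norm_of_nonneg (le_min (abs_nonneg _) (abs_nonneg _))]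
          exact mul_le_mul (min_le_right _ _) (hgC k y) (norm_nonneg _) (abs_nonneg _)
      have hb : ∀ k : ℤ, ‖(c (k + 1) - c k) • g (k + 1) y‖ ≤ C * ‖y‖ := fun k => by
        rw [norm_smul]
        exact (mul_le_mul (hc k) (hgC _ y) (norm_nonneg _) zero_le_one).trans_eq (one_mul _)
      let h : ℤ →ᵇ E := ofNormedAddCommGroup (fun k => (c (k + 1) - c k) • g (k + 1) y)
        continuous_of_discreteTopology (C * ‖y‖) hb
      have hx : x = R h := (hR x h).1 fun k => by
        change c (k + 1) • g (k + 1) y = NormedSpace.exp a (c k • g k y) +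
          (c (k + 1) - c k) • g (k + 1) y
        rw [sub_smul, add_sub_left_comm, left_eq_add, sub_eq_zero, ← he1, map_smul]
        rcases eq_or_ne k 0 with rfl | hk
        · simp [hc0]
        · rw [hgs k hk]
          rfl
      have hxn : ‖x n‖ ≤ C * (C * ‖y‖) := by
        rw [hx]
        refine ((R h).norm_coe_le_norm n).trans (R.le_of_opNorm_le_of_le hC ?_)
        exact norm_ofNormedAddCommGroup_le _ (by positivity) _
      have hcn : x n = |(n : ℝ)| • g n y := by
        change c n • g n y = _
        simp [c]
      rwa [hcn, ← mul_assoc] at hxn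
    have h2 := ContinuousLinearMap.opNorm_le_bound (|(n : ℝ)| • g n) (by positivity) h
    rwa [norm_smul, Real.norm_of_nonneg (abs_nonneg _)] at h2
  -- This `n` makes both `g (n + 2)` and `g (-n)` have norm at most `1 / 2`, which upgrades the
  -- decay `1 / |n|` to an exponential one.
  obtain ⟨n, hn⟩ := exists_nat_ge (2 * (C * C) + 1)
  have hCC : 0 < C * C := by positivity
  have hn0 : (0 : ℝ) < n := by linarith
  have h1 : ‖e (n + 1) * P‖ ≤ 1 / 2 := by
    have h2 := hdecay (n + 2)
    have h3 := hstab (n + 1)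
    push_cast at h2 h3
    rw [add_assoc, one_add_one_eq_two] at h3
    rw [h3]
    rw [abs_of_pos (by linarith)] at h2
    nlinarith [norm_nonneg (g (n + 2))]
  have h2 : ‖e (-(n + 1)) * (1 - P)‖ ≤ 1 / 2 := by
    rw [hunst n, norm_neg]
    have h2 := hdecay (-n)
    push_cast at h2
    rw [abs_neg, abs_of_pos hn0] at h2
    nlinarith [norm_nonneg (g (-n))]
  have hQQ : (1 - P) * (1 - P) = 1 - P := by
    rw [mul_sub, mul_one, sub_mul, one_mul, hPP, sub_self, sub_zero]
  have hcont : Continuous e := continuous_exp_smul a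
  obtain ⟨N₁, hN₁, ν₁, hν₁, hd₁⟩ := exists_exp_decay (S := fun t => e t * P)
    (hcont.mul continuous_const) (fun s t => by
      rw [mul_assoc, ← mul_assoc P, (hPe t).eq, mul_assoc, hPP, he, mul_assoc])
    (by positivity : (0 : ℝ) < n + 1) h1
  obtain ⟨N₂, hN₂, ν₂, hν₂, hd₂⟩ := exists_exp_decay (S := fun t => e (-t) * (1 - P))
    ((hcont.comp continuous_neg).mul continuous_const) (fun s t => by
      have hQe : Commute (1 - P) (e (-t)) := (Commute.one_left _).sub_left (hPe _)
      rw [mul_assoc, ← mul_assoc (1 - P), hQe.eq, mul_assoc, hQQ, neg_add, he, mul_assoc])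
    (by positivity : (0 : ℝ) < n + 1) h2
  have hle : ∀ {N ν t : ℝ}, 0 < N → N ≤ max N₁ N₂ → min ν₁ ν₂ ≤ ν → 0 ≤ t →
      N * Real.exp (-ν * t) ≤ max N₁ N₂ * Real.exp (-(min ν₁ ν₂) * t) := fun hN h h' ht =>
    mul_le_mul h (Real.exp_le_exp.2 (by nlinarith)) (Real.exp_pos _).le (hN.le.trans h)
  exact ⟨P, hPP, hPa, max N₁ N₂, lt_max_of_lt_left hN₁, min ν₁ ν₂, lt_min hν₁ hν₂,
    fun t ht => (hd₁ t ht).trans (hle hN₁ (le_max_left _ _) (min_le_left _ _) ht),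
    fun t ht => (hd₂ t ht).trans (hle hN₂ (le_max_right _ _) (min_le_right _ _) ht)⟩

end Dichotomy

end InvTorus

namespace InvTorus

/-! ### The complex spectrum of an element of a real algebra -/

section Spectrum

variable {R : Type*} [Ring R] [Algebra ℝ R]

/-- The real-part map from `ℂ ⊗ R` to `R` respects multiplication by elements of `R`, so it sends an
inverse of `1 ⊗ b` to an inverse of `b`. -/
theorem re_one_tmul_mul (b : R) (X : ℂ ⊗[ℝ] R) :
    TensorProduct.lid ℝ R (Complex.reLm.rTensor _ ((1 ⊗ₜ b) * X)) =
      b * TensorProduct.lid ℝ R (Complex.reLm.rTensor _ X) := by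
  induction X with
  | zero => simp
  | tmul z d => simp
  | add X Y hX hY => rw [mul_add, map_add, map_add, hX, hY, map_add, map_add, mul_add]

theorem re_mul_one_tmul (b : R) (X : ℂ ⊗[ℝ] R) :
    TensorProduct.lid ℝ R (Complex.reLm.rTensor _ (X * (1 ⊗ₜ b))) =
      TensorProduct.lid ℝ R (Complex.reLm.rTensor _ X) * b := by
  induction X with
  | zero => simp
  | tmul z d => simp
  | add X Y hX hY => rw [add_mul, map_add, map_add, hX, hY, map_add, map_add, add_mul]

theorem isUnit_of_isUnit_one_tmul {b : R}
    (h : IsUnit ((1 : ℂ) ⊗ₜ[ℝ] b : ℂ ⊗[ℝ] R)) : IsUnit b := by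
  obtain ⟨u, hu⟩ := h
  have h1 := re_one_tmul_mul b ↑u⁻¹
  have h2 := re_mul_one_tmul b ↑u⁻¹
  rw [← hu, Units.mul_inv, Algebra.TensorProduct.one_def] at h1
  rw [← hu, Units.inv_mul, Algebra.TensorProduct.one_def] at h2
  simp only [LinearMap.rTensor_tmul, TensorProduct.lid_tmul, Complex.reLm_coe, Complex.one_re,
    one_smul] at h1 h2
  exact ⟨⟨b, _, h1.symm, h2.symm⟩, rfl⟩

/-- If the complex spectrum of an element of a real algebra misses the imaginary axis, then
the negative of its square has no spectrum on the nonnegative half-line. -/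
theorem isUnit_sq_add_of_notMem_spectrum {a : R}
    (h : ∀ s : ℝ, (s : ℂ) * Complex.I ∉ spectrum ℂ ((1 : ℂ) ⊗ₜ[ℝ] a : ℂ ⊗[ℝ] R)) (s : ℝ) :
    IsUnit (a * a + algebraMap ℝ R (s ^ 2)) := by
  have h1 := h s
  rw [spectrum.notMem_iff, Algebra.TensorProduct.algebraMap_apply,
    Algebra.algebraMap_self_apply] at h1
  have h2 := h (-s)
  rw [spectrum.notMem_iff, Algebra.TensorProduct.algebraMap_apply,
    Algebra.algebraMap_self_apply] at h2
  refine isUnit_of_isUnit_one_tmul ?_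
  -- The factorization behind this is `(s i - a) (-s i - a) = a ^ 2 + s ^ 2`.
  convert h1.mul h2 using 1
  have h3 : (s : ℂ) * Complex.I * (((-s : ℝ) : ℂ) * Complex.I) = (s ^ 2) • (1 : ℂ) := by
    rw [Complex.real_smul]
    push_cast
    linear_combination (-(s : ℂ) ^ 2) * Complex.I_sq
  have h4 : ((-s : ℝ) : ℂ) * Complex.I = -((s : ℂ) * Complex.I) := by push_cast; ring
  rw [sub_mul, mul_sub, mul_sub]
  simp only [Algebra.TensorProduct.tmul_mul_tmul, one_mul, mul_one, h3]
  rw [TensorProduct.smul_tmul, ← Algebra.algebraMap_eq_smul_one, h4, TensorProduct.neg_tmul,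
    TensorProduct.tmul_add]
  abel

end Spectrum

/-! ### The linear equation in slow time -/

section SlowLinear

variable {Ω : Type*} [TopologicalSpace Ω]
variable {E : Type*} [NormedAddCommGroup E] [NormedSpace ℝ E] [CompleteSpace E]

theorem inverse_exp_smul (a : E →L[ℝ] E) (t : ℝ) :
    Ring.inverse (NormedSpace.exp (t • a)) = NormedSpace.exp ((-t) • a) := by
  have h : ∀ t : ℝ, NormedSpace.exp (t • a) * NormedSpace.exp ((-t) • a) = 1 := fun t => by
    rw [← exp_add_smul, add_neg_cancel, zero_smul, NormedSpace.exp_zero]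
  refine Ring.inverse_unit (⟨_, _, h t, ?_⟩ : (E →L[ℝ] E)ˣ)
  simpa using h (-t)

/-- An exponential dichotomy of an autonomous linear equation, in slow time. -/
theorem isHyperbolic_exp_smul (σ : Flow ℝ Ω) {a P : E →L[ℝ] E} {N ν ε : ℝ} (hN : 0 < N)
    (hν : 0 < ν) (hε : 0 < ε) (hP : P * P = P) (hPa : Commute P a)
    (hs : ∀ t : ℝ, 0 ≤ t → ‖NormedSpace.exp (t • a) * P‖ ≤ N * Real.exp (-ν * t))
    (hu : ∀ t : ℝ, 0 ≤ t → ‖NormedSpace.exp ((-t) • a) * (1 - P)‖ ≤ N * Real.exp (-ν * t)) :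
    IsHyperbolic σ (ContinuousMap.const Ω (ε • a)) (fun t _ => NormedSpace.exp (t • (ε • a)))
      (ContinuousMap.const Ω P) N (ε * ν) := by
  let _ : NormedAlgebra ℚ (E →L[ℝ] E) := .restrictScalars ℚ ℝ _
  have hcomm : ∀ t : ℝ, Commute P (NormedSpace.exp (t • (ε • a))) := fun t =>
    ((hPa.smul_right ε).smul_right t).exp_right
  have hcomm' : ∀ t : ℝ, Commute (1 - P) (NormedSpace.exp (t • (ε • a))) := fun t =>
    (Commute.one_left _).sub_left (hcomm t)
  refine ⟨⟨fun _ => by simp [NormedSpace.exp_zero], fun t _ => ?_⟩, hN, by positivity, fun _ => hP,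
    fun t _ => (hcomm t).symm, fun t τ _ h => ?_, fun t τ _ h => ?_⟩
  · exact hasDerivAt_exp_smul_const' (ε • a) t
  · have h1 := hs ((t - τ) * ε) (mul_nonneg (sub_nonneg.2 h) hε.le)
    rw [inverse_exp_smul, ContinuousMap.const_apply, mul_assoc, (hcomm _).eq, ← mul_assoc,
      ← exp_add_smul, ← sub_eq_add_neg, smul_smul]
    refine h1.trans_eq ?_
    congr 2
    ring
  · have h1 := hu ((τ - t) * ε) (mul_nonneg (sub_nonneg.2 h) hε.le)
    rw [inverse_exp_smul, ContinuousMap.const_apply, mul_assoc, (hcomm' _).eq, ← mul_assoc,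
      ← exp_add_smul, ← sub_eq_add_neg, smul_smul]
    rw [← neg_mul, neg_sub] at h1
    refine h1.trans_eq ?_
    congr 2
    ring

/-- The slow linear equation has a bounded solution operator whose norm is bounded independently of
the small parameter. -/
theorem exists_slow_solution_operator [CompactSpace Ω] [FirstCountableTopology Ω] (σ : Flow ℝ Ω)
    {a : E →L[ℝ] E} (ha : ∀ s : ℝ, (s : ℂ) * Complex.I ∉ complexSpectrum a) :
    ∃ C > 0, ∃ K : ℝ → C(Ω, E) →L[ℝ] C(Ω, E), ∀ ε > 0, ‖K ε‖ ≤ C ∧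
      ∀ u h : C(Ω, E), HasFlowDeriv σ u (fun ω => ε • (a (u ω) + h ω)) ↔ u = K ε h := by
  obtain ⟨P, hP, hPa, N, hN, ν, hν, hs, hu⟩ :=
    exists_dichotomy (isUnit_sq_add_of_notMem_spectrum ha)
  have key : ∀ ε : ℝ, 0 < ε → ∃ K : C(Ω, E) →L[ℝ] C(Ω, E), ‖K‖ ≤ 2 * N / ν ∧
      ∀ u h : C(Ω, E), HasFlowDeriv σ u (fun ω => ε • (a (u ω) + h ω)) ↔ u = K h := fun ε hε => by
    have hU := isHyperbolic_exp_smul σ hN hν hε hP hPa hs hu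
    -- The forcing is `ε • h` and the rate is `ε * ν`, so the factors `ε` cancel in the norm bound.
    refine ⟨ε • hU.boundedSolution, ?_, fun u h => ⟨fun hd => ?_, ?_⟩⟩
    · rw [norm_smul, Real.norm_of_nonneg hε.le]
      refine (mul_le_mul_of_nonneg_left hU.norm_boundedSolution_le hε.le).trans_eq ?_
      field_simp
    · rw [smul_apply, ← map_smul]
      exact hU.eq_boundedSolution (hd.congr (fun _ => rfl) fun ω => by simp)
    · rintro rfl
      rw [smul_apply, ← map_smul]
      exact (hU.hasFlowDeriv_boundedSolution (ε • h)).congr (fun _ => rfl) fun ω => by simp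
  choose! K hK hK' using key
  exact ⟨2 * N / ν, by positivity, K, fun ε hε => ⟨hK ε hε, hK' ε hε⟩⟩

end SlowLinear

/-! ### Approximate primitives along the flow -/

section Primitive

variable {Ω : Type*} [TopologicalSpace Ω] [CompactSpace Ω]
variable {V : Type*} [NormedAddCommGroup V] [NormedSpace ℝ V] [CompleteSpace V]

/-- A function with a uniform time average has a primitive along the flow, up to its average and a
small remainder. -/
theorem exists_flow_primitive {σ : Flow ℝ Ω} {h : C(Ω, V)} {hbar : V}
    (havg : TendstoUniformly (fun T ω => timeAverage σ h T ω) (fun _ => hbar) atTop) {δ : ℝ}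
    (hδ : 0 < δ) :
    ∃ W M : C(Ω, V), HasFlowDeriv σ W (fun ω => h ω - hbar - M ω) ∧ ‖M‖ ≤ δ := by
  obtain ⟨T, hT, hTpos⟩ := ((Metric.tendstoUniformly_iff.1 havg δ hδ).and
    (eventually_gt_atTop 0)).exists
  have hcont : Continuous fun p : Ω × ℝ => h (σ p.2 p.1) :=
    h.continuous.comp (σ.continuous continuous_snd continuous_fst)
  have hH : Continuous fun p : Ω × ℝ => ∫ τ in (0 : ℝ)..p.2, h (σ τ p.1) :=
    intervalIntegral.continuous_parametric_intervalIntegral_of_continuous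
      (f := fun (p : Ω × ℝ) τ => h (σ τ p.1))
      (hcont.comp ((continuous_fst.comp continuous_fst).prodMk continuous_snd)) continuous_snd
  have hM : Continuous fun ω => timeAverage σ h T ω - hbar :=
    ((hH.comp (continuous_id.prodMk continuous_const)).const_smul T⁻¹).sub continuous_const
  -- Averaging the partial integrals over `[0, T]` gives a function on the base. Along an orbit it
  -- differs from the primitive `H` by a moving average of `H`, so its derivative is `h` minus the
  -- time average of `h` over length `T`; that average is `hbar + M`.
  have hW : Continuous fun ω => -(T⁻¹ • ∫ t in (0 : ℝ)..T, ∫ τ in (0 : ℝ)..t, h (σ τ ω)) :=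
    ((intervalIntegral.continuous_parametric_intervalIntegral_of_continuous'
      (f := fun ω t => ∫ τ in (0 : ℝ)..t, h (σ τ ω)) hH 0 T).const_smul T⁻¹).neg
  refine ⟨⟨_, hW⟩, ⟨_, hM⟩, fun ω s => ?_, (ContinuousMap.norm_le _ hδ.le).2 fun ω => ?_⟩
  · simp only [ContinuousMap.coe_mk]
    have hω : Continuous fun τ => h (σ τ ω) := hcont.comp (continuous_const.prodMk continuous_id)
    let H : ℝ → V := fun t => ∫ τ in (0 : ℝ)..t, h (σ τ ω)
    have hHc : Continuous H := hH.comp (continuous_const.prodMk continuous_id)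
    have hHd : ∀ t, HasDerivAt H (h (σ t ω)) t := fun t =>
      intervalIntegral.integral_hasDerivAt_right (hω.intervalIntegrable _ _)
        (hω.stronglyMeasurableAtFilter _ _) hω.continuousAt
    let J : ℝ → V := fun t => ∫ τ in (0 : ℝ)..t, H τ
    have hJd : ∀ t, HasDerivAt J (H t) t := fun t =>
      intervalIntegral.integral_hasDerivAt_right (hHc.intervalIntegrable _ _)
        (hHc.stronglyMeasurableAtFilter _ _) hHc.continuousAt
    have hshift : ∀ s t : ℝ, ∫ τ in (0 : ℝ)..t, h (σ τ (σ s ω)) = H (t + s) - H s := fun s t => by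
      simp only [← σ.map_add]
      rw [intervalIntegral.integral_comp_add_right (fun τ => h (σ τ ω)), zero_add,
        intervalIntegral.integral_interval_sub_left (hω.intervalIntegrable _ _)
          (hω.intervalIntegrable _ _)]
    have hW' : ∀ s, -(T⁻¹ • ∫ t in (0 : ℝ)..T, ∫ τ in (0 : ℝ)..t, h (σ τ (σ s ω))) =
        H s - T⁻¹ • (J (s + T) - J s) := fun s => by
      have hHs : Continuous fun t => H (t + s) := hHc.comp (continuous_id.add continuous_const)
      simp only [hshift]
      rw [intervalIntegral.integral_sub (hHs.intervalIntegrable _ _)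
        intervalIntegrable_const, intervalIntegral.integral_comp_add_right H, zero_add,
        intervalIntegral.integral_const, sub_zero, smul_sub, smul_smul,
        inv_mul_cancel₀ hTpos.ne', one_smul, neg_sub, add_comm T s,
        intervalIntegral.integral_interval_sub_left (hHc.intervalIntegrable _ _)
          (hHc.intervalIntegrable _ _)]
    have hd := (hHd s).sub ((((hJd (s + T)).comp_add_const s T).sub (hJd s)).const_smul T⁻¹)
    have hd' : HasDerivAt
        (fun s => -(T⁻¹ • ∫ t in (0 : ℝ)..T, ∫ τ in (0 : ℝ)..t, h (σ τ (σ s ω))))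
        (h (σ s ω) - T⁻¹ • (H (s + T) - H s)) s := by
      simp only [hW']
      exact hd
    refine hd'.congr_deriv ?_
    rw [timeAverage, hshift, add_comm T s]
    abel
  · have := hT ω
    rw [dist_comm, dist_eq_norm] at this
    exact this.le

end Primitive

end InvTorus

namespace InvTorus

/-! ### A fixed point theorem for a linear part with small square -/

section AbstractFixedPoint

variable {X : Type*} [NormedAddCommGroup X] [NormedSpace ℝ X] [CompleteSpace X]

/-- If the square of `L` is small, then `1 - L` is invertible. -/
theorem exists_inverse_one_sub {L : X →L[ℝ] X} {l : ℝ} (hL2 : ‖L * L‖ ≤ 1 / 2) (hL : ‖L‖ ≤ l) :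
    ∃ J : X →L[ℝ] X, J * (1 - L) = 1 ∧ (1 - L) * J = 1 ∧ ‖J‖ ≤ 2 * (1 + l) := by
  have hlt : ‖L * L‖ < 1 := by linarith
  -- The inverse sought is `(1 + L) * (1 - L * L)⁻¹`, and the second factor has norm at most `2`.
  set u := Units.oneSub (L * L) hlt with hu
  have huval : (u : X →L[ℝ] X) = 1 - L * L := rfl
  set R : X →L[ℝ] X := ↑u⁻¹ with hR
  have h1 : R * (1 - L * L) = 1 := by rw [← huval, hR, Units.inv_mul]
  have h2 : (1 - L * L) * R = 1 := by rw [← huval, hR, Units.mul_inv]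
  have hone : ‖(1 : X →L[ℝ] X)‖ ≤ 1 := ContinuousLinearMap.norm_id_le
  have hRn : ‖R‖ ≤ 2 := by
    have h3 : R = 1 + L * L * R := by rw [sub_mul, one_mul, sub_eq_iff_eq_add] at h2; exact h2
    have h4 : ‖R‖ ≤ 1 + 1 / 2 * ‖R‖ := by
      conv_lhs => rw [h3]
      refine (norm_add_le _ _).trans (add_le_add hone ?_)
      exact (norm_mul_le _ _).trans (mul_le_mul_of_nonneg_right hL2 (norm_nonneg _))
    linarith
  have hcomm : Commute L R := by
    have h3 : Commute L u := by
      rw [huval]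
      exact (Commute.one_right L).sub_right ((Commute.refl L).mul_right (Commute.refl L))
    exact h3.units_inv_right
  refine ⟨(1 + L) * R, ?_, ?_, ?_⟩
  · have h3 : Commute R (1 - L) := (Commute.one_right R).sub_right hcomm.symm
    rw [mul_assoc, h3.eq, ← mul_assoc]
    have h4 : (1 + L) * (1 - L) = 1 - L * L := by noncomm_ring
    rw [h4, h2]
  · have h4 : (1 - L) * (1 + L) = 1 - L * L := by noncomm_ring
    rw [← mul_assoc, h4, h2]
  · rw [mul_comm]
    have h5 : ‖1 + L‖ ≤ 1 + l := (norm_add_le _ _).trans (add_le_add hone hL)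
    rw [mul_comm]
    calc ‖(1 + L) * R‖ ≤ ‖1 + L‖ * ‖R‖ := norm_mul_le _ _
      _ ≤ (1 + l) * 2 := mul_le_mul h5 hRn (norm_nonneg _) ((norm_nonneg _).trans h5)
      _ = 2 * (1 + l) := mul_comm _ _

/-- A fixed point theorem in which the linear part only has a small square. -/
theorem existsUnique_fixedPoint_of_sq_small {L K : X →L[ℝ] X} {c : X} {Q : X → X}
    {l C κ ρ : ℝ} (hL2 : ‖L * L‖ ≤ 1 / 2) (hL : ‖L‖ ≤ l) (hK : ‖K‖ ≤ C) (hρ : 0 < ρ)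
    (hQ0 : Q 0 = 0) (hQ : ∀ u ∈ Metric.closedBall (0 : X) ρ, ∀ v ∈ Metric.closedBall (0 : X) ρ,
      ‖Q u - Q v‖ ≤ κ * ‖u - v‖) (hsmall : 2 * (1 + l) * C * κ ≤ 1 / 2)
    (hc : 2 * (1 + l) * ‖c‖ ≤ ρ / 2) :
    ∃! u, u ∈ Metric.closedBall (0 : X) ρ ∧ u = L u + c + K (Q u) := by
  obtain ⟨J, hJ1, hJ2, hJn⟩ := exists_inverse_one_sub hL2 hL
  have hl : 0 ≤ l := (norm_nonneg _).trans hL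
  have hC : 0 ≤ C := (norm_nonneg _).trans hK
  have hlip : ∀ u ∈ Metric.closedBall (0 : X) ρ, ∀ v ∈ Metric.closedBall (0 : X) ρ,
      ‖J (K (Q u - Q v))‖ ≤ 1 / 2 * ‖u - v‖ := fun u hu v hv => by
    have h1 : ‖K (Q u - Q v)‖ ≤ C * (κ * ‖u - v‖) := K.le_of_opNorm_le_of_le hK (hQ u hu v hv)
    calc ‖J (K (Q u - Q v))‖ ≤ 2 * (1 + l) * (C * (κ * ‖u - v‖)) := J.le_of_opNorm_le_of_le hJn h1
      _ = 2 * (1 + l) * C * κ * ‖u - v‖ := by ring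
      _ ≤ _ := mul_le_mul_of_nonneg_right hsmall (norm_nonneg _)
  have hiff : ∀ u, J (c + K (Q u)) = u ↔ u = L u + c + K (Q u) := fun u => by
    have h1 : ∀ x, J ((1 - L) x) = x := fun x => DFunLike.congr_fun hJ1 x
    have h2 : ∀ x, (1 - L) (J x) = x := fun x => DFunLike.congr_fun hJ2 x
    constructor
    · intro h
      have h3 := h2 (c + K (Q u))
      rw [h, sub_apply, one_apply_eq_self, sub_eq_iff_eq_add'] at h3
      rw [add_assoc]
      exact h3
    · intro h
      have h3 : (1 - L) u = c + K (Q u) := by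
        rw [sub_apply, one_apply_eq_self, sub_eq_iff_eq_add', ← add_assoc]
        exact h
      rw [← h3, h1]
  have h0 : (0 : X) ∈ Metric.closedBall (0 : X) ρ := Metric.mem_closedBall_self hρ.le
  have := existsUnique_fixedPoint_closedBall (S := fun u => J (c + K (Q u))) (c := (0 : X))
    (ρ := ρ) (q := 1 / 2) hρ.le (by norm_num) (by norm_num)
    (fun u hu => by
      have h1 := hlip u hu 0 h0
      rw [hQ0, sub_zero, sub_zero] at h1
      have h2 : ‖J c‖ ≤ 2 * (1 + l) * ‖c‖ := J.le_of_opNorm_le hJn c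
      rw [mem_closedBall_zero_iff] at hu ⊢
      dsimp only
      rw [map_add]
      have h3 := norm_add_le (J c) (J (K (Q u)))
      linarith)
    (fun u hu v hv => by
      rw [dist_eq_norm, dist_eq_norm, ← map_sub, add_sub_add_left_eq_sub, ← map_sub]
      exact hlip u hu v hv)
  simpa only [hiff] using this

end AbstractFixedPoint

/-! ### Slow response to oscillating terms -/

section Oscillation

variable {Ω : Type*} [TopologicalSpace Ω] [CompactSpace Ω]
variable {E : Type*} [NormedAddCommGroup E] [NormedSpace ℝ E]

/-- The multiplication operator by a continuous family of operators. -/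
noncomputable def pointwiseApply (B : C(Ω, E →L[ℝ] E)) : C(Ω, E) →L[ℝ] C(Ω, E) :=
  LinearMap.mkContinuous
    { toFun := fun u => ⟨fun ω => B ω (u ω), B.continuous.clm_apply u.continuous⟩
      map_add' := fun u v => by ext ω; simp
      map_smul' := fun c u => by ext ω; simp } ‖B‖ fun u =>
    (ContinuousMap.norm_le _ (by positivity)).2 fun ω =>
      (B ω).le_of_opNorm_le_of_le (B.norm_coe_le_norm ω) (u.norm_coe_le_norm ω)

theorem pointwiseApply_apply (B : C(Ω, E →L[ℝ] E)) (u : C(Ω, E)) (ω : Ω) :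
    pointwiseApply B u ω = B ω (u ω) := rfl

theorem norm_pointwiseApply_le (B : C(Ω, E →L[ℝ] E)) : ‖pointwiseApply B‖ ≤ ‖B‖ :=
  LinearMap.mkContinuous_norm_le _ (norm_nonneg B) _

variable [CompleteSpace E] {σ : Flow ℝ Ω} {a : E →L[ℝ] E} {C : ℝ}
  {K : ℝ → C(Ω, E) →L[ℝ] C(Ω, E)}

/-- The slow response to an oscillating forcing term is small. -/
theorem eventually_norm_slow_solution_le (hC : 0 < C) (hK : ∀ ε > 0, ‖K ε‖ ≤ C ∧
      ∀ u h : C(Ω, E), HasFlowDeriv σ u (fun ω => ε • (a (u ω) + h ω)) ↔ u = K ε h)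
    {h : C(Ω, E)} (havg : TendstoUniformly (fun T ω => timeAverage σ h T ω) (fun _ => 0) atTop)
    {δ : ℝ} (hδ : 0 < δ) : ∀ᶠ ε in 𝓝[>] (0 : ℝ), ‖K ε h‖ ≤ δ := by
  obtain ⟨W, M, hW, hM⟩ := exists_flow_primitive havg (δ := δ / (2 * C)) (by positivity)
  have hlim : Tendsto (fun ε : ℝ => ε * (‖W‖ + C * (‖a‖ * ‖W‖))) (𝓝[>] 0) (𝓝 0) := by
    have : Tendsto (fun ε : ℝ => ε * (‖W‖ + C * (‖a‖ * ‖W‖))) (𝓝 0) (𝓝 0) := by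
      simpa using (tendsto_id (x := 𝓝 (0 : ℝ))).mul_const (‖W‖ + C * (‖a‖ * ‖W‖))
    exact this.mono_left nhdsWithin_le_nhds
  filter_upwards [hlim.eventually (gt_mem_nhds (half_pos hδ)), self_mem_nhdsWithin] with ε hε hε0
  have hε0 : 0 < ε := hε0
  obtain ⟨hKn, hKi⟩ := hK ε hε0
  let aW : C(Ω, E) := pointwiseApply (ContinuousMap.const Ω a) W
  have haW : ‖aW‖ ≤ ‖a‖ * ‖W‖ := by
    refine (ContinuousMap.norm_le _ (by positivity)).2 fun ω => ?_
    exact a.le_opNorm_of_le (W.norm_coe_le_norm ω)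
  -- Subtracting `ε • W` cancels the forcing `h` and leaves the slow equation with the small forcing
  -- `ε • aW + M`.
  have hz : K ε h - ε • W = K ε (ε • aW + M) := by
    refine (hKi _ _).1 ((((hKi _ h).2 rfl).sub (hW.const_smul ε)).congr (fun _ => rfl) fun ω => ?_)
    simp only [aW, ContinuousMap.sub_apply, ContinuousMap.add_apply, ContinuousMap.smul_apply,
      pointwiseApply_apply, ContinuousMap.const_apply, map_sub, map_smul, sub_zero]
    module
  have h1 : ‖ε • aW + M‖ ≤ ε * (‖a‖ * ‖W‖) + δ / (2 * C) := by
    refine (norm_add_le _ _).trans (add_le_add ?_ hM)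
    rw [norm_smul, Real.norm_of_nonneg hε0.le]
    exact mul_le_mul_of_nonneg_left haW hε0.le
  have h2 := (K ε).le_of_opNorm_le_of_le hKn h1
  have h3 : ‖ε • W‖ = ε * ‖W‖ := by rw [norm_smul, Real.norm_of_nonneg hε0.le]
  have h4 : ‖K ε h‖ ≤ ‖ε • W‖ + ‖K ε (ε • aW + M)‖ := by
    rw [← hz]
    have := norm_add_le (ε • W) (K ε h - ε • W)
    rwa [add_sub_cancel] at this
  have h5 : C * (ε * (‖a‖ * ‖W‖) + δ / (2 * C)) = ε * (C * (‖a‖ * ‖W‖)) + δ / 2 := by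
    field_simp
  rw [h3] at h4
  rw [h5] at h2
  linarith

/-- The square of the slow response to an oscillating linear term is small. -/
theorem eventually_norm_slow_solution_sq_le (hC : 0 < C) (hK : ∀ ε > 0, ‖K ε‖ ≤ C ∧
      ∀ u h : C(Ω, E), HasFlowDeriv σ u (fun ω => ε • (a (u ω) + h ω)) ↔ u = K ε h)
    {A B : C(Ω, E →L[ℝ] E)} {b : E →L[ℝ] E} (hB : ∀ ω, B ω = A ω - b)
    (havg : TendstoUniformly (fun T ω => timeAverage σ A T ω) (fun _ => b) atTop)
    {δ : ℝ} (hδ : 0 < δ) : ∀ᶠ ε in 𝓝[>] (0 : ℝ),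
      ‖(K ε * pointwiseApply B) * (K ε * pointwiseApply B)‖ ≤ δ := by
  set l : ℝ := C * ‖B‖ with hl
  have hl0 : 0 ≤ l := by positivity
  -- The remainder enters through `K ε * (m' * L)`, of norm at most `C * ‖M‖ * l`; this choice keeps
  -- it below `δ / 2`, also when `l = 0`.
  obtain ⟨W, M, hW, hM⟩ := exists_flow_primitive havg (δ := δ / (2 * C * (l + 1))) (by positivity)
  set w : ℝ := ‖W‖ with hw
  set k : ℝ := w * l + C * (‖a‖ * (w * l) + w * (‖a‖ * l + ‖B‖)) with hk
  have hlim : Tendsto (fun ε : ℝ => ε * k) (𝓝[>] 0) (𝓝 0) := by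
    have : Tendsto (fun ε : ℝ => ε * k) (𝓝 0) (𝓝 0) := by
      simpa using (tendsto_id (x := 𝓝 (0 : ℝ))).mul_const k
    exact this.mono_left nhdsWithin_le_nhds
  filter_upwards [hlim.eventually (gt_mem_nhds (half_pos hδ)), self_mem_nhdsWithin] with ε hε hε0
  have hε0 : 0 < ε := hε0
  obtain ⟨hKn, hKi⟩ := hK ε hε0
  set b' := pointwiseApply B with hb'
  set w' := pointwiseApply W with hw'
  set m' := pointwiseApply M with hm'
  set a' : C(Ω, E) →L[ℝ] C(Ω, E) := pointwiseApply (ContinuousMap.const Ω a) with ha'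
  set L := K ε * b' with hL
  have hb'n : ‖b'‖ ≤ ‖B‖ := norm_pointwiseApply_le B
  have hw'n : ‖w'‖ ≤ w := norm_pointwiseApply_le W
  have hm'n : ‖m'‖ ≤ δ / (2 * C * (l + 1)) := (norm_pointwiseApply_le M).trans hM
  have ha'n : ‖a'‖ ≤ ‖a‖ := (norm_pointwiseApply_le _).trans
    ((ContinuousMap.norm_le _ (norm_nonneg _)).2 fun _ => le_rfl)
  have hLn : ‖L‖ ≤ l := (norm_mul_le _ _).trans (mul_le_mul hKn hb'n (norm_nonneg _) hC.le)
  -- Here the square matters: `v = L u` has derivative of order `ε` along the flow, whereas `u` is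
  -- merely continuous. So `ε • W v` can be differentiated, and subtracting it from `L v` trades the
  -- forcing `B v` for `M v` and terms of order `ε`.
  have hid : L * L = ε • (w' * L) +
      K ε * (ε • (a' * (w' * L)) + m' * L - ε • (w' * (a' * L + b'))) := by
    refine ContinuousLinearMap.ext fun u => ?_
    have hv := (hKi _ (b' u)).2 rfl
    have hz := (hKi _ (b' (L u))).2 rfl
    have hWv := (hW.clm_apply hv).const_smul ε
    have h1 : K ε (b' (L u)) - ε • w' (L u) =
        K ε (ε • a' (w' (L u)) + m' (L u) - ε • w' (a' (L u) + b' u)) := by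
      refine (hKi _ _).1 ((hz.sub hWv).congr (fun _ => rfl) fun ω => ?_)
      have hLω : K ε (b' u) = L u := rfl
      simp only [hLω, b', w', m', a', ContinuousMap.sub_apply, ContinuousMap.add_apply,
        ContinuousMap.smul_apply, pointwiseApply_apply, ContinuousMap.const_apply, map_sub,
        map_add, map_smul, hB, sub_apply]
      module
    exact sub_eq_iff_eq_add'.1 h1
  have hwL : ‖w' * L‖ ≤ w * l :=
    (norm_mul_le _ _).trans (mul_le_mul hw'n hLn (norm_nonneg _) (norm_nonneg _))
  have hsm : ∀ (x : C(Ω, E) →L[ℝ] C(Ω, E)) (y : ℝ), ‖x‖ ≤ y → ‖ε • x‖ ≤ ε * y := fun x y hxy => by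
    rw [norm_smul, Real.norm_of_nonneg hε0.le]
    exact mul_le_mul_of_nonneg_left hxy hε0.le
  have h1 : ‖ε • (a' * (w' * L))‖ ≤ ε * (‖a‖ * (w * l)) :=
    hsm _ _ ((norm_mul_le _ _).trans (mul_le_mul ha'n hwL (norm_nonneg _) (norm_nonneg _)))
  have h2 : ‖m' * L‖ ≤ δ / (2 * C * (l + 1)) * l :=
    (norm_mul_le _ _).trans (mul_le_mul hm'n hLn (norm_nonneg _) (by positivity))
  have h3 : ‖ε • (w' * (a' * L + b'))‖ ≤ ε * (w * (‖a‖ * l + ‖B‖)) := by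
    refine hsm _ _ ((norm_mul_le _ _).trans (mul_le_mul hw'n ?_ (norm_nonneg _) (norm_nonneg _)))
    refine (norm_add_le _ _).trans (add_le_add ?_ hb'n)
    exact (norm_mul_le _ _).trans (mul_le_mul ha'n hLn (norm_nonneg _) (norm_nonneg _))
  have h4 : ‖ε • (a' * (w' * L)) + m' * L - ε • (w' * (a' * L + b'))‖ ≤
      ε * (‖a‖ * (w * l)) + δ / (2 * C * (l + 1)) * l + ε * (w * (‖a‖ * l + ‖B‖)) :=
    (norm_sub_le _ _).trans (add_le_add ((norm_add_le _ _).trans (add_le_add h1 h2)) h3)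
  have h5 := (norm_mul_le _ _).trans (mul_le_mul hKn h4 (norm_nonneg _) hC.le)
  have h6 : C * (δ / (2 * C * (l + 1)) * l) ≤ δ / 2 := by
    have : C * (δ / (2 * C * (l + 1)) * l) = δ / 2 * (l / (l + 1)) := by field_simp
    rw [this]
    exact mul_le_of_le_one_right (by positivity) ((div_le_one (by positivity)).2 (by linarith))
  have h7 := hsm _ _ hwL
  have h8 := norm_add_le (ε • (w' * L))
    (K ε * (ε • (a' * (w' * L)) + m' * L - ε • (w' * (a' * L + b'))))
  rw [← hid] at h8
  have h9 : C * (ε * (‖a‖ * (w * l)) + δ / (2 * C * (l + 1)) * l + ε * (w * (‖a‖ * l + ‖B‖))) =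
      ε * k - ε * (w * l) + C * (δ / (2 * C * (l + 1)) * l) := by
    rw [hk]; ring
  linarith

end Oscillation

end InvTorus

/-! ### Averaging near a hyperbolic stationary point -/

namespace InvTorus

theorem UniformAverage.tendstoUniformly {Ω E V : Type*} [TopologicalSpace Ω] {σ : Flow ℝ Ω}
    [NormedAddCommGroup V] [NormedSpace ℝ V]
    {B : Set E} {g : Ω → E → V} {gbar : E → V} (h : UniformAverage σ B g gbar) {x : E}
    (hx : x ∈ B) :
    TendstoUniformly (fun T ω => timeAverage σ (fun ω => g ω x) T ω) (fun _ => gbar x) atTop :=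
  fun s hs => (h s hs).mono fun _ hT ω => hT (ω, x) ⟨mem_univ _, hx⟩

section Averaging

variable {Ω : Type*} [TopologicalSpace Ω]
variable {E : Type*} [NormedAddCommGroup E] [NormedSpace ℝ E]
variable {σ : Flow ℝ Ω} {f : Ω → E → E} {fbar : E → E} {x₀ : E} {r : ℝ}

namespace AveragingConditions

theorem center_mem (h : AveragingConditions σ f fbar x₀ r) : x₀ ∈ Metric.closedBall x₀ r :=
  Metric.mem_closedBall_self h.r_pos.le

theorem hasFDerivWithinAt (h : AveragingConditions σ f fbar x₀ r) (ω : Ω) {x : E}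
    (hx : x ∈ Metric.closedBall x₀ r) : HasFDerivWithinAt (f ω)
      (deriv₁ (Metric.closedBall x₀ r) (f ω) x) (Metric.closedBall x₀ r) x :=
  ((h.contDiffOn ω).differentiableOn two_ne_zero x hx).hasFDerivWithinAt

/-- Solutions of the equation in standard form are unique as long as they stay in the ball. -/
theorem eqOn_of_isSolution (h : AveragingConditions σ f fbar x₀ r) {ε : ℝ} {ω : Ω} {y z : ℝ → E}
    (hy : IsSolution σ (fun ω x => ε • f ω x) (Metric.closedBall x₀ r) ω y)
    (hz : IsSolution σ (fun ω x => ε • f ω x) (Metric.closedBall x₀ r) ω z) (h0 : y 0 = z 0) :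
    EqOn y z (Ici 0) := by
  obtain ⟨M, hM⟩ := h.bounded_deriv
  have hlip : ∀ t, LipschitzOnWith (‖ε‖₊ * M.toNNReal) (fun x => ε • f (σ t ω) x)
      (Metric.closedBall x₀ r) := fun t => by
    have h1 : LipschitzOnWith M.toNNReal (f (σ t ω)) (Metric.closedBall x₀ r) :=
      (convex_closedBall x₀ r).lipschitzOnWith_of_nnnorm_hasFDerivWithin_le
        (fun x hx => h.hasFDerivWithinAt _ hx) fun x hx => by
          rw [← NNReal.coe_le_coe, coe_nnnorm]
          exact (hM _ x hx).trans (Real.le_coe_toNNReal M)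
    exact (lipschitzWith_smul ε).comp_lipschitzOnWith h1
  have hcont : ∀ {y : ℝ → E},
      IsSolution σ (fun ω x => ε • f ω x) (Metric.closedBall x₀ r) ω y → ∀ T,
        ContinuousOn y (Icc 0 T) := fun hy T t ht =>
    ((hy t ht.1).2.continuousWithinAt).mono Icc_subset_Ici_self
  intro T hT
  exact ODE_solution_unique_of_mem_Icc_right (v := fun t x => ε • f (σ t ω) x)
    (s := fun _ => Metric.closedBall x₀ r) (fun t _ => hlip t) (hcont hy T)
    (fun t ht => (hy t ht.1).2.mono (Ici_subset_Ici.2 ht.1)) (fun t ht => (hy t ht.1).1)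
    (hcont hz T) (fun t ht => (hz t ht.1).2.mono (Ici_subset_Ici.2 ht.1))
    (fun t ht => (hz t ht.1).1) h0 ⟨hT, le_rfl⟩

/-- Existence on `ℝ₊` is witnessed by `u` along the orbit, and uniqueness follows from the bounded
derivative on the ball. -/
theorem isInvariantTorus (h : AveragingConditions σ f fbar x₀ r) {ε : ℝ} {u : C(Ω, E)}
    (hu : HasFlowDeriv σ u fun ω => ε • f ω (u ω)) (hD : ∀ ω, u ω ∈ Metric.closedBall x₀ r) :
    IsInvariantTorus σ (fun ω x => ε • f ω x) (Metric.closedBall x₀ r) u := by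
  have hs := HasFlowDeriv.isSolution (G := fun ω x => ε • f ω x) hu hD
  refine HasFlowDeriv.isInvariantTorus (G := fun ω x => ε • f ω x) hu hD fun ω =>
    ⟨_, ⟨hs ω, by simp [σ.map_zero_apply]⟩, fun z hz hz0 => h.eqOn_of_isSolution hz (hs ω) ?_⟩
  simp [hz0, σ.map_zero_apply]

variable [CompactSpace Ω]

/-- Joint continuity of the derivative and compactness of the base make the radius uniform in `ω`.
-/
theorem exists_deriv_close (h : AveragingConditions σ f fbar x₀ r) {κ : ℝ} (hκ : 0 < κ) :
    ∃ ρ, 0 < ρ ∧ ρ ≤ r ∧ ∀ ω, ∀ x ∈ Metric.closedBall x₀ ρ,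
      ‖deriv₁ (Metric.closedBall x₀ r) (f ω) x - deriv₁ (Metric.closedBall x₀ r) (f ω) x₀‖ ≤ κ := by
  have hc : Continuous fun ω => deriv₁ (Metric.closedBall x₀ r) (f ω) x₀ :=
    h.continuousOn_deriv₁.comp_continuous (f := fun ω => (ω, x₀)) (by fun_prop)
      fun ω => ⟨mem_univ _, h.center_mem⟩
  have hev : ∀ᶠ x in 𝓝 x₀, ∀ ω ∈ (univ : Set Ω), ‖deriv₁ (Metric.closedBall x₀ r) (f ω) x -
      deriv₁ (Metric.closedBall x₀ r) (f ω) x₀‖ < κ := by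
    refine isCompact_univ.eventually_forall_of_forall_eventually fun ω _ => ?_
    have hnhds : (univ : Set Ω) ×ˢ Metric.closedBall x₀ r ∈ 𝓝 (ω, x₀) :=
      prod_mem_nhds univ_mem (Metric.closedBall_mem_nhds x₀ h.r_pos)
    have h1 : ContinuousAt (fun p : Ω × E => ‖deriv₁ (Metric.closedBall x₀ r) (f p.1) p.2 -
        deriv₁ (Metric.closedBall x₀ r) (f p.1) x₀‖) (ω, x₀) :=
      ((h.continuousOn_deriv₁.continuousAt hnhds).sub (hc.comp continuous_fst).continuousAt).norm
    have h2 : ContinuousAt (fun p : E × Ω => ‖deriv₁ (Metric.closedBall x₀ r) (f p.2) p.1 -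
        deriv₁ (Metric.closedBall x₀ r) (f p.2) x₀‖) (x₀, ω) :=
      ContinuousAt.comp (f := Prod.swap) (g := fun p : Ω × E =>
        ‖deriv₁ (Metric.closedBall x₀ r) (f p.1) p.2 -
          deriv₁ (Metric.closedBall x₀ r) (f p.1) x₀‖) h1 continuous_swap.continuousAt
    exact h2.eventually (gt_mem_nhds (by simpa using hκ))
  obtain ⟨δ, hδ, hball⟩ := Metric.eventually_nhds_iff.1 hev
  refine ⟨min r (δ / 2), lt_min h.r_pos (by positivity), min_le_left _ _, fun ω x hx => ?_⟩
  have h3 := (Metric.mem_closedBall.1 hx).trans (min_le_right _ _)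
  exact (hball (by linarith) ω (mem_univ ω)).le

/-- Near a hyperbolic stationary point of the averaged equation, the equation in standard form has
exactly one solution that is a continuous function on the base of the driving flow. -/
theorem exists_unique_flow_solution [CompleteSpace E] [FirstCountableTopology Ω]
    (h : AveragingConditions σ f fbar x₀ r) :
    ∃ ρ, 0 < ρ ∧ ρ ≤ r ∧ ∀ r₀ ∈ Ioc 0 ρ, ∃ ε₁ > (0 : ℝ),
      ∀ ε ∈ Ioo 0 ε₁, ∃! u : C(Ω, E), (∀ ω, u ω ∈ Metric.closedBall x₀ r₀) ∧
        HasFlowDeriv σ u fun ω => ε • f ω (u ω) := by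
  set D := Metric.closedBall x₀ r with hD
  have hDn : D ∈ 𝓝 x₀ := Metric.closedBall_mem_nhds x₀ h.r_pos
  set a : E →L[ℝ] E := fderiv ℝ fbar x₀ with ha
  have hderiv_avg : deriv₁ D fbar x₀ = a := fderivWithin_of_mem_nhds hDn
  obtain ⟨C, hC, K, hK⟩ := exists_slow_solution_operator σ h.hyperbolic
  let A : C(Ω, E →L[ℝ] E) := ⟨fun ω => deriv₁ D (f ω) x₀,
    h.continuousOn_deriv₁.comp_continuous (f := fun ω => (ω, x₀)) (by fun_prop)
      fun ω => ⟨mem_univ _, h.center_mem⟩⟩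
  have hA : ∀ ω, A ω = deriv₁ D (f ω) x₀ := fun _ => rfl
  let f₀ : C(Ω, E) := ⟨fun ω => f ω x₀,
    h.continuousOn.comp_continuous (f := fun ω => (ω, x₀)) (by fun_prop)
      fun ω => ⟨mem_univ _, h.center_mem⟩⟩
  have hf₀ : ∀ ω, f₀ ω = f ω x₀ := fun _ => rfl
  let B : C(Ω, E →L[ℝ] E) := A - ContinuousMap.const Ω a
  have hB : ∀ ω, B ω = A ω - a := fun _ => rfl
  have havgA : TendstoUniformly (fun T ω => timeAverage σ A T ω) (fun _ => a) atTop := by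
    have := h.average_deriv₁.tendstoUniformly h.center_mem
    rwa [hderiv_avg] at this
  have havgf : TendstoUniformly (fun T ω => timeAverage σ f₀ T ω) (fun _ => 0) atTop := by
    have := h.average.tendstoUniformly h.center_mem
    rwa [h.stationary] at this
  set l := C * ‖B‖ with hl
  have hl0 : 0 ≤ l := by positivity
  obtain ⟨ρ, hρ, hρr, hclose⟩ := h.exists_deriv_close
    (κ := 1 / (4 * (1 + l) * C)) (by positivity)
  -- This is the largest `κ` with `2 * (1 + l) * C * κ ≤ 1 / 2`. It does not involve `ε`, hence
  -- neither does `ρ`.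
  set κ := 1 / (4 * (1 + l) * C) with hκ
  -- the remainder after linearization
  have hrem : ∀ ω (x y : E), x₀ + x ∈ Metric.closedBall x₀ ρ → x₀ + y ∈ Metric.closedBall x₀ ρ →
      ‖f ω (x₀ + x) - f ω (x₀ + y) - A ω (x - y)‖ ≤ κ * ‖x - y‖ := fun ω x y hx hy => by
    have h1 := (convex_closedBall x₀ ρ).norm_image_sub_le_of_norm_hasFDerivWithin_le' (f := f ω)
      (f' := fun x => deriv₁ D (f ω) x) (φ := A ω) (C := κ) (fun z hz =>
        (h.hasFDerivWithinAt ω (Metric.closedBall_subset_closedBall hρr hz)).mono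
          (Metric.closedBall_subset_closedBall hρr)) (fun z hz => hclose ω z hz) hy hx
    rwa [add_sub_add_left_eq_sub] at h1
  refine ⟨ρ, hρ, hρr, fun r₀ hr₀ => ?_⟩
  have hmem : ∀ {s : ℝ} {x : E}, ‖x‖ ≤ s → x₀ + x ∈ Metric.closedBall x₀ s := fun hx => by
    rwa [Metric.mem_closedBall, dist_eq_norm, add_sub_cancel_left]
  have hcontQ : ∀ u : C(Ω, E), ‖u‖ ≤ ρ →
      Continuous fun ω => f ω (x₀ + u ω) - f ω x₀ - A ω (u ω) := fun u hu => by
    refine Continuous.sub (Continuous.sub ?_ f₀.continuous) (A.continuous.clm_apply u.continuous)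
    exact h.continuousOn.comp_continuous (f := fun ω => (ω, x₀ + u ω)) (by fun_prop) fun ω =>
      ⟨mem_univ _, Metric.closedBall_subset_closedBall hρr (hmem ((u.norm_coe_le_norm ω).trans hu))⟩
  classical
  -- Outside the ball `x₀ + u` may leave the domain of `f`; the value `0` there is never used.
  let Q : C(Ω, E) → C(Ω, E) := fun u => if hu : ‖u‖ ≤ ρ then ⟨_, hcontQ u hu⟩ else 0
  have hQ : ∀ u, ‖u‖ ≤ ρ → ∀ ω, Q u ω = f ω (x₀ + u ω) - f ω x₀ - A ω (u ω) := fun u hu ω => by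
    simp only [Q, dif_pos hu, ContinuousMap.coe_mk]
  have hQ0 : Q 0 = 0 := by
    ext ω
    rw [hQ 0 (by simpa using hρ.le)]
    simp
  have hQlip : ∀ u ∈ Metric.closedBall (0 : C(Ω, E)) r₀, ∀ v ∈ Metric.closedBall (0 : C(Ω, E)) r₀,
      ‖Q u - Q v‖ ≤ κ * ‖u - v‖ := fun u hu v hv => by
    have hu' := (mem_closedBall_zero_iff.1 hu).trans hr₀.2
    have hv' := (mem_closedBall_zero_iff.1 hv).trans hr₀.2
    refine (ContinuousMap.norm_le _ (by positivity)).2 fun ω => ?_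
    have h1 := hrem ω (u ω) (v ω) (hmem ((u.norm_coe_le_norm ω).trans hu'))
      (hmem ((v.norm_coe_le_norm ω).trans hv'))
    have h2 : (Q u - Q v) ω = f ω (x₀ + u ω) - f ω (x₀ + v ω) - A ω (u ω - v ω) := by
      rw [ContinuousMap.sub_apply, hQ u hu', hQ v hv', map_sub]
      abel
    rw [h2]
    exact h1.trans (mul_le_mul_of_nonneg_left ((u - v).norm_coe_le_norm ω) (by positivity))
  -- The bound `r₀ / (4 * (1 + l))` is what the fixed point theorem needs for its constant term.
  have hev := (eventually_norm_slow_solution_sq_le hC hK hB havgA (δ := 1 / 2) (by norm_num)).and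
    (eventually_norm_slow_solution_le hC hK havgf (δ := r₀ / (4 * (1 + l)))
      (div_pos hr₀.1 (by positivity)))
  obtain ⟨ε₁, hε₁, hsub⟩ := mem_nhdsGT_iff_exists_Ioo_subset.1 hev
  refine ⟨ε₁, hε₁, fun ε hε => ?_⟩
  obtain ⟨hL2, hc⟩ := hsub hε
  obtain ⟨hKn, hKi⟩ := hK ε hε.1
  have hLn : ‖K ε * pointwiseApply B‖ ≤ l :=
    (norm_mul_le _ _).trans (mul_le_mul hKn (norm_pointwiseApply_le B) (norm_nonneg _) hC.le)
  obtain ⟨y, ⟨hy, hyeq⟩, hyuniq⟩ := existsUnique_fixedPoint_of_sq_small (Q := Q) hL2 hLn hKn hr₀.1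
    hQ0 hQlip (by rw [hκ]; field_simp; norm_num)
    (c := K ε f₀) (by
      rw [le_div_iff₀ (by positivity)] at hc
      linarith)
  have hiff : ∀ y : C(Ω, E), y ∈ Metric.closedBall (0 : C(Ω, E)) r₀ →
      ((HasFlowDeriv σ y fun ω => ε • f ω (x₀ + y ω)) ↔
        y = (K ε * pointwiseApply B) y + K ε f₀ + K ε (Q y)) := fun y hy => by
    have hy' := (mem_closedBall_zero_iff.1 hy).trans hr₀.2
    have h1 : (K ε * pointwiseApply B) y + K ε f₀ + K ε (Q y) =
        K ε (pointwiseApply B y + f₀ + Q y) := by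
      rw [map_add, map_add]; rfl
    rw [h1, ← hKi]
    -- The field splits into the averaged linear part `a`, the oscillating linear part `B`, the
    -- oscillating constant `f₀` and the remainder `Q`.
    have h2 : (fun ω => ε • f ω (x₀ + y ω)) =
        fun ω => ε • (a (y ω) + (pointwiseApply B y + f₀ + Q y) ω) := by
      funext ω
      rw [ContinuousMap.add_apply, ContinuousMap.add_apply, pointwiseApply_apply, hQ y hy', hB,
        sub_apply, hf₀]
      congr 1
      abel
    rw [h2]
  have hball : ∀ u : C(Ω, E), (∀ ω, u ω ∈ Metric.closedBall x₀ r₀) ↔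
      u - ContinuousMap.const Ω x₀ ∈ Metric.closedBall (0 : C(Ω, E)) r₀ := fun u => by
    rw [mem_closedBall_zero_iff, ContinuousMap.norm_le _ hr₀.1.le]
    simp [dist_eq_norm]
  have hderiv : ∀ u : C(Ω, E), (HasFlowDeriv σ u fun ω => ε • f ω (u ω)) ↔
      HasFlowDeriv σ (u - ContinuousMap.const Ω x₀)
        fun ω => ε • f ω (x₀ + (u - ContinuousMap.const Ω x₀) ω) := fun u => by
    simp only [HasFlowDeriv, ContinuousMap.sub_apply, ContinuousMap.const_apply, add_sub_cancel,
      hasDerivAt_sub_const_iff]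
  refine ⟨y + ContinuousMap.const Ω x₀, ⟨?_, ?_⟩, fun u hu => ?_⟩
  · rw [hball, add_sub_cancel_right]
    exact hy
  · show HasFlowDeriv σ _ _
    rw [hderiv, add_sub_cancel_right, hiff y hy]
    exact hyeq
  · have h1 := (hball u).1 hu.1
    have h2 := (hiff _ h1).1 ((hderiv u).1 hu.2)
    rw [← hyuniq _ ⟨h1, h2⟩, sub_add_cancel]

/-- Invariant tori near a hyperbolic stationary point of the averaged equation. -/
theorem exists_torus_family [CompleteSpace E] [FirstCountableTopology Ω] [T2Space Ω]
    (hmin : IsCompactMinimal univ (fun t ω => σ t ω) univ)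
    (hqp : ∀ ω, IsQuasiPeriodicOn univ (fun t => σ t ω))
    (h : AveragingConditions σ f fbar x₀ r) :
    ∃ ρ > 0, ∀ r₀ ∈ Ioc 0 ρ, ∃ ε₁ > 0, ∃ u : ℝ → C(Ω, E),
      (∀ ε ∈ Ioo 0 ε₁,
        (∀ ω, u ε ω ∈ Metric.closedBall x₀ r₀) ∧
        IsMinimalQuasiPeriodicTorus σ (fun ω x => ε • f ω x) (Metric.closedBall x₀ r) (u ε) ∧
        ∀ v : C(Ω, E), (∀ ω, v ω ∈ Metric.closedBall x₀ r₀) →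
          IsInvariantTorus σ (fun ω x => ε • f ω x) (Metric.closedBall x₀ r) v → v = u ε) ∧
      Tendsto (fun ε => ⨆ ω, ‖u ε ω - x₀‖) (𝓝[>] 0) (𝓝 0) := by
  obtain ⟨ρ, hρ, hρr, hex⟩ := h.exists_unique_flow_solution
  refine ⟨ρ, hρ, fun r₀ hr₀ => ?_⟩
  obtain ⟨ε₁, hε₁, hu⟩ := hex r₀ hr₀
  choose! u hu huniq using hu
  refine ⟨ε₁, hε₁, u, fun ε hε => ⟨(hu ε hε).1, ?_, fun v hv hinv => ?_⟩, ?_⟩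
  · exact (h.isInvariantTorus (hu ε hε).2 fun ω => Metric.closedBall_subset_closedBall
      (hr₀.2.trans hρr) ((hu ε hε).1 ω)).isMinimalQuasiPeriodicTorus hmin hqp
  · exact huniq ε hε v ⟨hv, hinv.hasFlowDeriv⟩
  · rw [Metric.tendsto_nhds]
    intro δ hδ
    -- Existence in the smaller ball combined with uniqueness in the ball of radius `r₀` shows that
    -- `u ε` itself lies within `δ / 2` of `x₀`.
    obtain ⟨ε₂, hε₂, hu₂⟩ := hex (min r₀ (δ / 2))
      ⟨lt_min hr₀.1 (by positivity), (min_le_left _ _).trans hr₀.2⟩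
    filter_upwards [Ioo_mem_nhdsGT (lt_min hε₁ hε₂)] with ε hε
    have hεε₁ : ε ∈ Ioo 0 ε₁ := ⟨hε.1, hε.2.trans_le (min_le_left _ _)⟩
    obtain ⟨v, ⟨hv, hvd⟩, -⟩ := hu₂ ε ⟨hε.1, hε.2.trans_le (min_le_right _ _)⟩
    obtain rfl : v = u ε := huniq ε hεε₁ v
      ⟨fun ω => Metric.closedBall_subset_closedBall (min_le_left _ _) (hv ω), hvd⟩
    rw [Real.dist_eq, sub_zero, abs_of_nonneg (Real.iSup_nonneg fun _ => norm_nonneg _)]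
    refine lt_of_le_of_lt (Real.iSup_le (fun ω => ?_) (half_pos hδ).le) (half_lt_self hδ)
    rw [← dist_eq_norm]
    exact (Metric.mem_closedBall.1 (hv ω)).trans (min_le_right _ _)

end AveragingConditions

end Averaging

end InvTorus

theorem corollary5p4 {m : ℕ} {E : Type*} [NormedAddCommGroup E] [NormedSpace ℝ E] [CompleteSpace E]
    (Φ : C(UnitAddTorus (Fin m), Fin m → ℝ)) (σ : Flow ℝ (UnitAddTorus (Fin m)))
    (hΦ : InvTorus.Generates Φ σ)
    (hmin : InvTorus.IsCompactMinimal univ (fun t ω => σ t ω) univ)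
    (hqp : ∀ ω, InvTorus.IsQuasiPeriodicOn univ (fun t => σ t ω)) :
    -- quasilinear equation
    (∀ (A : C(UnitAddTorus (Fin m), E →L[ℝ] E)) (f : C(UnitAddTorus (Fin m), E))
        (F : C(UnitAddTorus (Fin m) × E, E)) (U : ℝ → UnitAddTorus (Fin m) → E →L[ℝ] E)
        (P : C(UnitAddTorus (Fin m), E →L[ℝ] E)) (N ν L r : ℝ),
      InvTorus.IsHyperbolic σ A U P N ν →
      0 < L → L < ν / (2 * N) →
      0 < r → (⨆ ω, ‖F (ω, InvTorus.linearTorus σ U P f ω)‖) / (ν / (2 * N) - L) ≤ r →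
      InvTorus.LipschitzInSpace F (InvTorus.tube (InvTorus.linearTorus σ U P f) r) L →
      (∀ ω x, InvTorus.HasUniqueSolution σ (InvTorus.quasilinear A f F) univ ω x) →
      ∃ u : C(UnitAddTorus (Fin m), E),
        InvTorus.IsMinimalQuasiPeriodicTorus σ (InvTorus.quasilinear A f F) univ u) ∧
    -- perturbed quasilinear equation
    (∀ (A : C(UnitAddTorus (Fin m), E →L[ℝ] E)) (f : C(UnitAddTorus (Fin m), E))
        (F : C(UnitAddTorus (Fin m) × E, E)) (U : ℝ → UnitAddTorus (Fin m) → E →L[ℝ] E)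
        (P : C(UnitAddTorus (Fin m), E →L[ℝ] E)) (N ν L r ε₀ : ℝ),
      InvTorus.IsHyperbolic σ A U P N ν →
      0 < L → 0 < r → 0 < ε₀ →
      InvTorus.LipschitzInSpace F (InvTorus.tube (InvTorus.linearTorus σ U P f) r) L →
      (∀ ε ∈ Icc 0 ε₀, ∀ ω x,
        InvTorus.HasUniqueSolution σ (InvTorus.quasilinear A f (ε • F)) univ ω x) →
      ∃ ε₁ ∈ Ioc 0 ε₀, ∃ u : ℝ → C(UnitAddTorus (Fin m), E),
        (∀ ε ∈ Icc 0 ε₁,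
          InvTorus.IsMinimalQuasiPeriodicTorus σ (InvTorus.quasilinear A f (ε • F)) univ (u ε)) ∧
        Tendsto (fun ε => ⨆ ω, ‖u ε ω - u 0 ω‖) (𝓝[>] 0) (𝓝 0)) ∧
    -- equation in standard form, near a hyperbolic stationary point of the averaged equation
    (∀ (f : UnitAddTorus (Fin m) → E → E) (fbar : E → E) (x₀ : E) (r : ℝ),
      InvTorus.AveragingConditions σ f fbar x₀ r →
      ∃ ρ > 0, ∀ r₀ ∈ Ioc 0 ρ, ∃ ε₁ > 0, ∃ u : ℝ → C(UnitAddTorus (Fin m), E),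
        (∀ ε ∈ Ioo 0 ε₁,
          (∀ ω, u ε ω ∈ Metric.closedBall x₀ r₀) ∧
          InvTorus.IsMinimalQuasiPeriodicTorus σ (fun ω x => ε • f ω x)
            (Metric.closedBall x₀ r) (u ε) ∧
          ∀ v : C(UnitAddTorus (Fin m), E), (∀ ω, v ω ∈ Metric.closedBall x₀ r₀) →
            InvTorus.IsInvariantTorus σ (fun ω x => ε • f ω x) (Metric.closedBall x₀ r) v →
            v = u ε) ∧
        Tendsto (fun ε => ⨆ ω, ‖u ε ω - x₀‖) (𝓝[>] 0) (𝓝 0)) := by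
  refine ⟨?_, ?_, fun f fbar x₀ r h => h.exists_torus_family hmin hqp⟩
  · intro A f F U P N ν L r hU hL0 hL _ hr hF huniq
    obtain ⟨u, hu, -⟩ := hU.exists_torus_quasilinear hmin hqp hL0.le hL hr hF huniq
    exact ⟨u, hu⟩
  · intro A f F U P N ν L r ε₀ hU hL hr hε₀ hF huniq
    exact hU.exists_torus_family hmin hqp hL hr hε₀ hF huniq
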